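/- **Setting.** Let $k,n\ge 0$ be integers and $\mathbb T^k=[-1/2,1/2)^k$ with Lebesgue measure. For $f\in L^2(\mathbb R^k)$ and $\ell\in\mathbb Z^k$ put $T_\ell f(x)=f(x-\ell)$, and let $\Gamma f(x)=(\hat f(x+\ell))_{\ell\in\mathbb Z^k}\in\ell^2(\mathbb Z^k)$ for a.e. $x\in\mathbb T^k$, where $\hat f$ is the Fourier transform of $f$. For a finite sequence $\mathcal F=(f_1,\dots,f_m)$ in $L^2(\mathbb R^k)$ let $E(\mathcal F)=(T_\ell f_i)_{\ell\in\mathbb Z^k,\,1\le i\le m}$. If $E(\mathcal F)$ is a Bessel sequence with synthesis operator $T_{E(\mathcal F)}$, let $S_{E(\mathcal F)}=T_{E(\mathcal F)}T_{E(\mathcal F)}^*$ be its frame operator, and let $[S_{E(\mathcal F)}]$ be the (a.e. unique) weakly measurable, essentially bounded field of operators on $\ell^2(\mathbb Z^k)$ with $[S_{E(\mathcal F)}]_x\,\Gamma f(x)=\Gamma(S_{E(\mathcal F)}f)(x)$ for a.e. $x$, for every $f\in L^2(\mathbb R^k)$. For a.e. $x$ this is a positive finite rank operator; $\lambda_1([S_{E(\mathcal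 F)}]_x)\ge\lambda_2([S_{E(\mathcal F)}]_x)\ge\dots$ are its eigenvalues counted with multiplicity, continued by zeros. Let $\mathcal W\subset L^2(\mathbb R^k)$ be a finitely generated shift invariant subspace, that is, the closed linear span of all integer translates of the elements of some finite set. Let $J_{\mathcal W}$ be its measurable range function: the (a.e. unique) field of closed subspaces of $\ell^2(\mathbb Z^k)$ with weakly measurable orthogonal projections such that $f\in\mathcal W$ if and only if $\Gamma f(x)\in J_{\mathcal W}(x)$ for a.e. $x$. Let $d(x)=\dim J_{\mathcal W}(x)$. Let $\lambda_i,\alpha_i:\mathbb T^k\to[0,\infty)$, $1\le i\le n$, be measurable functions, with every $\lambda_i$ essentially bounded, that satisfy the admissibility conditions 1. for every $1\le i\le n$, $\lambda_i(x)=0$ for a.e. $x\in\mathbb T^k$ such that $i\ge\min\{n,d(x)\}+1$; 2. for a.e. $x\in\mathbb T^k$, with the convention $\lambda_i=0$ for $i>n$: $\sum_{i=1}^{p}\alpha_i(x)\le\sum_{i=1}^{p}\lambda_i(x)$ for $1\le p\le\min\{n,d(x)\}$, and $\sum_{i=1}^{n}\alpha_i(x)=\sum_{i=1}^{d(x)}\lambda_i(x)$.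 A *sequence of eigensteps* for $(\lambda,\alpha)$ is a family of measurable functions $\lambda_{i,j}:\mathbb T^k\to[0,\infty)$, $1\le i\le j\le n$, such that for a.e. $x\in\mathbb T^k$: * $\lambda_{i,j+1}(x)\ge\lambda_{i,j}(x)\ge\lambda_{i+1,j+1}(x)$ for $1\le i\le j\le n-1$; * $\sum_{i=1}^{j}\lambda_{i,j}(x)=\sum_{i=1}^{j}\alpha_i(x)$ for $1\le j\le n$; * $\lambda_{i,n}(x)=\lambda_i(x)$ for $1\le i\le n$. For $\mathcal F=(f_1,\dots,f_n)$ with $E(\mathcal F)$ Bessel write $\mathcal F_j=(f_1,\dots,f_j)$. The family $(\lambda_{i,j})$ is *associated* to $\mathcal F$ if, for every $1\le j\le n$ and a.e. $x$, $\lambda_i([S_{E(\mathcal F_j)}]_x)=\lambda_{i,j}(x)$ for $1\le i\le j$ and $\lambda_i([S_{E(\mathcal F_j)}]_x)=0$ for $i>j$. We say that $\mathcal F$ *has fine structure* $(\lambda,\alpha)$ if for a.e. $x$ one has $\lambda_i([S_{E(\mathcal F)}]_x)=\lambda_i(x)$ and $\|\Gamma f_i(x)\|^2=\alpha_i(x)$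 for $1\le i\le n$, and $\lambda_i([S_{E(\mathcal F)}]_x)=0$ for $i>n$. **Theorem.** For every sequence of eigensteps $((\lambda_{i,j})_{1\le i\le j})_{1\le j\le n}$ for $(\lambda,\alpha)$ there exists $\mathcal F=(f_1,\dots,f_n)\in\mathcal W^n$ such that $E(\mathcal F)$ is a Bessel sequence, $((\lambda_{i,j})_{1\le i\le j})_{1\le j\le n}$ is associated to $\mathcal F$, and $\mathcal F$ has fine structure $(\lambda,\alpha)$. Conversely, for every $\mathcal F\in\mathcal W^n$ such that $E(\mathcal F)$ is a Bessel sequence and $\mathcal F$ has fine structure $(\lambda,\alpha)$, there is a sequence of eigensteps for $(\lambda,\alpha)$ that is associated to $\mathcal F$. -/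

import Mathlib

open MeasureTheory
open scoped NNReal FourierTransform

namespace ShiftGenerated

noncomputable section

/-- The space `L²(ℝᵏ)` of complex valued square integrable functions. -/
abbrev L2 (k : ℕ) : Type := Lp ℂ 2 (volume : Measure (EuclideanSpace ℝ (Fin k)))

/-- The space `ℓ²(ℤᵏ)`. -/
abbrev SeqL2 (k : ℕ) : Type := lp (fun _ : Fin k → ℤ => ℂ) 2

/-- The integer vector `ℓ ∈ ℤᵏ`, seen as a point of `ℝᵏ`. -/
def intVec {k : ℕ} (l : Fin k → ℤ) : EuclideanSpace ℝ (Fin k) :=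
  WithLp.toLp 2 (fun i => (l i : ℝ))

/-- The torus `𝕋ᵏ = [-1/2, 1/2)ᵏ`; as a type it carries the restricted Lebesgue measure. -/
def torus (k : ℕ) : Set (EuclideanSpace ℝ (Fin k)) :=
  {x | ∀ i, x i ∈ Set.Ico (-(1 / 2) : ℝ) (1 / 2)}

instance instMeasureSpaceTorus (k : ℕ) : MeasureSpace (torus k) :=
  Measure.Subtype.measureSpace

/-- The integer translate `T_ℓ f (x) = f (x - ℓ)` of `f ∈ L²(ℝᵏ)`. -/
def shiftBy {k : ℕ} (l : Fin k → ℤ) (f : L2 k) : L2 k :=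
  Lp.compMeasurePreserving (fun x => x - intVec l) (measurePreserving_sub_right volume (intVec l)) f

/-- The shift invariant space generated by `A`: the closed span of the integer translates of the
elements of `A`. -/
def shiftSpan {k : ℕ} (A : Set (L2 k)) : Submodule ℂ (L2 k) :=
  (Submodule.span ℂ {g | ∃ f ∈ A, ∃ l : Fin k → ℤ, g = shiftBy l f}).topologicalClosure

/-- Finitely generated shift invariant (FSI) subspaces of `L²(ℝᵏ)`. -/
def IsFSI {k : ℕ} (W : Submodule ℂ (L2 k)) : Prop :=
  ∃ A : Set (L2 k), A.Finite ∧ W = shiftSpan A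

open Classical in
/-- The fiber `Γ f (x) = (f̂ (x + ℓ))_{ℓ ∈ ℤᵏ} ∈ ℓ²(ℤᵏ)`, where `f̂` is the `L²`-Fourier transform.
The sequence is square summable for almost every `x`; on the remaining null set the value is `0`. -/
def fiber {k : ℕ} (f : L2 k) (x : torus k) : SeqL2 k :=
  if h : Memℓp (fun l : Fin k → ℤ => (𝓕 f : L2 k) ((x : EuclideanSpace ℝ (Fin k)) + intVec l)) 2
  then ⟨_, h⟩ else 0

/-- `J` is a measurable range function that represents `W`: the field of orthogonal projections
onto `J x` is weakly measurable, and `W` consists of the `f` with `Γ f (x) ∈ J x` almost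
everywhere. -/
def IsRangeFunction {k : ℕ} (W : Submodule ℂ (L2 k))
    (J : torus k → ClosedSubmodule ℂ (SeqL2 k)) : Prop :=
  (∀ ξ η : SeqL2 k, AEMeasurable
    (fun x : torus k => inner ℂ η ((J x).toSubmodule.starProjection ξ)) volume) ∧
  ∀ f : L2 k, f ∈ W ↔ ∀ᵐ x : torus k, fiber f x ∈ J x

/-- The measurable range function `J_W` of a shift invariant space `W` (it exists and is unique
up to null sets, and a representative is chosen). -/
def rangeFunction {k : ℕ} (W : Submodule ℂ (L2 k)) : torus k → ClosedSubmodule ℂ (SeqL2 k) :=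
  Classical.epsilon (IsRangeFunction W)

/-- The dimension function `d(x) = dim J_W(x)`. -/
def fiberDim {k : ℕ} (W : Submodule ℂ (L2 k)) (x : torus k) : ℕ :=
  Module.finrank ℂ (rangeFunction W x).toSubmodule

/-- A Bessel sequence `g` in a Hilbert space. -/
def IsBessel {H ι : Type*} [NormedAddCommGroup H] [InnerProductSpace ℂ H] (g : ι → H) : Prop :=
  ∃ b : ℝ, 0 < b ∧ ∀ f : H, Summable (fun i => ‖inner ℂ (g i) f‖ ^ 2) ∧
    ∑' i, ‖inner ℂ (g i) f‖ ^ 2 ≤ b * ‖f‖ ^ 2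

/-- `S` is the frame operator `T T*` of the sequence `g`, where `T : ℓ²(ι) → H`,
`T a = ∑ aᵢ gᵢ`, is its (bounded) synthesis operator. -/
def IsFrameOperator {H ι : Type*} [NormedAddCommGroup H] [InnerProductSpace ℂ H] [CompleteSpace H]
    (g : ι → H) (S : H →L[ℂ] H) : Prop :=
  ∃ T : lp (fun _ : ι => ℂ) 2 →L[ℂ] H,
    (∀ a : lp (fun _ : ι => ℂ) 2, HasSum (fun i => a i • g i) (T a)) ∧
    S = T.comp (ContinuousLinearMap.adjoint T)

/-- The sequence `E(F)` of integer translates of a finite sequence `F`. -/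
def shiftSeq {k m : ℕ} (F : Fin m → L2 k) : (Fin k → ℤ) × Fin m → L2 k :=
  fun p => shiftBy p.1 (F p.2)

/-- `s = [S]` is the field of operators on the fibers that represents the operator `S`:
it is weakly measurable, essentially bounded, and `[S]_x (Γ f (x)) = Γ (S f) (x)` a.e. -/
def IsFiberField {k : ℕ} (S : L2 k →L[ℂ] L2 k) (s : torus k → SeqL2 k →L[ℂ] SeqL2 k) : Prop :=
  (∀ ξ η : SeqL2 k, AEMeasurable (fun x : torus k => inner ℂ η (s x ξ)) volume) ∧
  (∃ C : ℝ, ∀ᵐ x : torus k, ‖s x‖ ≤ C) ∧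
  ∀ f : L2 k, ∀ᵐ x : torus k, s x (fiber f x) = fiber (S f) x

/-- `μ` is the sequence of eigenvalues of the positive finite rank operator `A`, counted with
multiplicity, in non-increasing order, and continued by zeros. -/
def IsEigenvalueSeq {H : Type*} [NormedAddCommGroup H] [InnerProductSpace ℂ H]
    (A : H →L[ℂ] H) (μ : ℕ → ℝ≥0) : Prop :=
  Antitone μ ∧ ∃ (r : ℕ) (v : Fin r → H), Orthonormal ℂ v ∧ (∀ i, r ≤ i → μ i = 0) ∧
    ∀ ξ : H, A ξ = ∑ i : Fin r, ((μ i : ℝ) : ℂ) • inner ℂ (v i) ξ • v i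

/-- Extension by zero of a finite sequence to an infinite one. -/
def zeroExt {m : ℕ} (a : Fin m → ℝ≥0) (i : ℕ) : ℝ≥0 :=
  if h : i < m then a ⟨i, h⟩ else 0

/-- `(μ₁, …, μ_m, 0, 0, …)` is the fine spectral structure of `E(G)`: the eigenvalues of
`[S_{E(G)}]_x` are `μ₁(x), …, μ_m(x), 0, 0, …` for almost every `x`. -/
def HasFineSpectrum {k m : ℕ} (G : Fin m → L2 k) (μ : Fin m → torus k → ℝ≥0) : Prop :=
  ∃ (S : L2 k →L[ℂ] L2 k) (s : torus k → SeqL2 k →L[ℂ] SeqL2 k),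
    IsFrameOperator (shiftSeq G) S ∧ IsFiberField S s ∧
    ∀ᵐ x : torus k, IsEigenvalueSeq (s x) (zeroExt fun i => μ i x)

/-- `E(F)` has the fine structure prescribed by `(lam, al)`: its fine spectral structure is
`lam`, and `‖Γ fᵢ(x)‖² = alᵢ(x)` almost everywhere. -/
def HasFineStructure {k n : ℕ} (F : Fin n → L2 k) (lam al : Fin n → torus k → ℝ≥0) : Prop :=
  HasFineSpectrum F lam ∧ ∀ i, ∀ᵐ x : torus k, ‖fiber (F i) x‖ ^ 2 = (al i x : ℝ)

/-- Majorization `a ≺ b` between vectors of possibly different lengths `n` and `m`: partial sums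
up to `min n m` are compared in the given order of the entries, and the totals agree. -/
def Majorized {n m : ℕ} (a : Fin n → ℝ≥0) (b : Fin m → ℝ≥0) : Prop :=
  (∀ p ≤ min n m, ∑ i ∈ Finset.range p, zeroExt a i ≤ ∑ i ∈ Finset.range p, zeroExt b i) ∧
  ∑ i, a i = ∑ i, b i

/-- The admissibility conditions. Indices start at `0` here, so that the first condition says
that the `i`-th function (`i ≥ min {n, d(x)} + 1`) vanishes at `x`. In the second one, the finite
sequence `lam` is continued by zeros if `d(x) > n`. -/
def Admissible {k n : ℕ} (W : Submodule ℂ (L2 k)) (lam al : Fin n → torus k → ℝ≥0) : Prop :=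
  (∀ i : Fin n, ∀ᵐ x : torus k, min n (fiberDim W x) ≤ (i : ℕ) → lam i x = 0) ∧
  ∀ᵐ x : torus k, Majorized (fun i => al i x)
    (fun i : Fin (fiberDim W x) => zeroExt (fun i' => lam i' x) i)

/-- Sequences of eigensteps for `(lam, al)`. With indices starting at `0`, the function `L j i`,
`i ≤ j < n`, is the one usually written `λ_{i+1, j+1}`. -/
structure IsEigensteps {k n : ℕ} (lam al : Fin n → torus k → ℝ≥0)
    (L : (j : Fin n) → Fin (j + 1) → torus k → ℝ≥0) : Prop where
  measurable : ∀ j i, AEMeasurable (L j i) volume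
  interlacing : ∀ (j : ℕ) (hj : j + 1 < n) (i : Fin (j + 1)), ∀ᵐ x : torus k,
    L ⟨j, Nat.lt_of_succ_lt hj⟩ i x ≤ L ⟨j + 1, hj⟩ i.castSucc x ∧
    L ⟨j + 1, hj⟩ i.succ x ≤ L ⟨j, Nat.lt_of_succ_lt hj⟩ i x
  trace : ∀ j : Fin n, ∀ᵐ x : torus k,
    ∑ i, L j i x = ∑ i : Fin (j + 1), al (Fin.castLE j.isLt i) x
  final : ∀ j : Fin n, (j : ℕ) + 1 = n → ∀ i, ∀ᵐ x : torus k,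
    L j i x = lam (Fin.castLE j.isLt i) x

/-- `L` is the sequence of eigensteps associated to `F`: for every `j` the functions `L j i` are
the eigenvalues of `[S_j]_x`, with `S_j` the frame operator of the translates of the first
members of `F`, up to and including number `j`. -/
def IsAssociated {k n : ℕ} (F : Fin n → L2 k)
    (L : (j : Fin n) → Fin (j + 1) → torus k → ℝ≥0) : Prop :=
  ∀ j : Fin n, HasFineSpectrum (fun i : Fin (j + 1) => F (Fin.castLE j.isLt i)) (L j)

end

end ShiftGenerated

open ShiftGenerated

/-! The map f ↦ Γf is an isometry of L²(ℝᵏ) onto the square integrable fields 𝕋ᵏ → ℓ²(ℤᵏ)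
(`inner_eq_integral_fiber`, `exists_fiber_eq`), and it turns T_ℓ into multiplication by a character
of the torus. Hence the numbers ⟨T_ℓ f, g⟩ are the Fourier coefficients of x ↦ ⟨Γf(x), Γg(x)⟩. For
generators with essentially bounded fibers, Parseval shows that the frame operator of E(F) acts on
the fiber at x as the frame operator of the vectors Γfᵢ(x) (`exists_isFrameOperator`,
`hasFineSpectrum_iff`). The equality of totals in the admissibility conditions bounds αᵢ, so the
fibers are bounded in both directions. What remains is linear algebra for n vectors at almost every
x, and measurability in x. The link to matrices is that a finite frame operator and the Gram matrix
have the same nonzero eigenvalues (`isEigenvalueSeq_frameOp`).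

From vectors to eigensteps: one more vector adds a positive rank one operator, so the spectra
interlace by a Courant-Fischer comparison (`IsEigenvalueSeq.le_of_codim`), and the trace of the Gram
matrix gives the sum conditions.

From eigensteps to vectors: interlacing spectra belong to the leading principal submatrices of a
real symmetric matrix, built by adding one row and column at a time (`exists_border`). Writing it as
VᵀV, with V the square root of the eigenvalues times the transposed eigenvector matrix, gives VVᵀ =
diag(λ). The columns of V serve as coordinates in a measurable orthonormal field of J_W. Rows of
index beyond d(x) vanish because there λ does, so no room is lacking in J_W(x).

Measurability in both directions comes from one principle: the unknowns lie in a fixed compact set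
and solve continuous equations with measurable right hand side, so the lexicographically smallest
solution is measurable (`exists_measurable_lexMin`). -/

namespace ShiftGenerated

noncomputable section

/-! ### Eigenvalues of finite frame operators and Gram matrices -/

section SpectralTheory

open Polynomial in
/-- A decreasing real sequence is determined by the polynomial whose roots it lists. -/
theorem antitone_eq_of_prod_X_sub_C_eq {𝕜 : Type*} [RCLike 𝕜] {m : ℕ} {μ ν : Fin m → ℝ}
    (hμ : Antitone μ) (hν : Antitone ν)
    (h : ∏ i, (X - C (μ i : 𝕜)) = ∏ i, (X - C (ν i : 𝕜))) : μ = ν := by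
  have hr : ∀ a : Fin m → ℝ, (∏ i, (X - C (a i : 𝕜))).roots
      = Multiset.map (fun i => (a i : 𝕜)) Finset.univ.val := by
    intro a
    rw [Polynomial.roots_prod _ _ (by
      simp [Finset.prod_ne_zero_iff, Polynomial.X_sub_C_ne_zero])]
    simp
  have h1 := congrArg (fun p => Multiset.map RCLike.re (Polynomial.roots p)) h
  simp only [hr, Multiset.map_map, Function.comp_def, RCLike.ofReal_re] at h1
  have h2 : (List.ofFn μ).Perm (List.ofFn ν) := by
    rw [← Multiset.coe_eq_coe]
    simpa [Fin.univ_val_map] using h1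
  exact List.ofFn_injective (h2.eq_of_sortedGE hμ.sortedGE_ofFn hν.sortedGE_ofFn)

open Polynomial in
/-- The spectral theorem for Hermitian matrices, with sorted eigenvalues. -/
theorem exists_antitone_eigenvalues {𝕜 : Type*} [RCLike 𝕜] {m : ℕ} {G : Matrix (Fin m) (Fin m) 𝕜}
    (hG : G.IsHermitian) :
    ∃ (ν : Fin m → ℝ) (w : OrthonormalBasis (Fin m) 𝕜 (EuclideanSpace 𝕜 (Fin m))),
      Antitone ν ∧ (∀ i, Matrix.toEuclideanLin G (w i) = (ν i : 𝕜) • w i) ∧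
      G.charpoly = ∏ i, (X - C (ν i : 𝕜)) := by
  have hT := Matrix.isSymmetric_toEuclideanLin_iff.mpr hG
  have hn : Module.finrank 𝕜 (EuclideanSpace 𝕜 (Fin m)) = m := by simp
  refine ⟨hT.eigenvalues hn, hT.eigenvectorBasis hn, hT.eigenvalues_antitone hn,
    fun i => hT.apply_eigenvectorBasis hn i, ?_⟩
  rw [← hT.charpoly_eq hn]
  have : Matrix.toEuclideanLin G = Matrix.toLin (EuclideanSpace.basisFun (Fin m) 𝕜).toBasis
      (EuclideanSpace.basisFun (Fin m) 𝕜).toBasis G := by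
    rfl
  rw [this, ← LinearMap.charpoly_toMatrix _ (EuclideanSpace.basisFun (Fin m) 𝕜).toBasis,
    LinearMap.toMatrix_toLin]

variable {H : Type*} [NormedAddCommGroup H] [InnerProductSpace ℂ H]

/-- The frame operator `ξ ↦ ∑ ⟨φᵢ, ξ⟩ φᵢ` of a finite sequence of vectors. -/
def frameOp {m : ℕ} (φ : Fin m → H) : H →L[ℂ] H :=
  ∑ i, (innerSL ℂ (φ i)).smulRight (φ i)

theorem frameOp_apply {m : ℕ} (φ : Fin m → H) (ξ : H) :
    frameOp φ ξ = ∑ i, inner ℂ (φ i) ξ • φ i := by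
  simp [frameOp]

theorem norm_frameOp_le {m : ℕ} (φ : Fin m → H) : ‖frameOp φ‖ ≤ ∑ i, ‖φ i‖ ^ 2 := by
  refine (norm_sum_le _ _).trans (Finset.sum_le_sum fun i _ => ?_)
  rw [ContinuousLinearMap.norm_smulRight_apply, innerSL_apply_norm, sq]

theorem re_inner_frameOp {m : ℕ} (φ : Fin m → H) (ξ : H) :
    (inner ℂ ξ (frameOp φ ξ)).re = ∑ i, ‖inner ℂ (φ i) ξ‖ ^ 2 := by
  rw [frameOp_apply, inner_sum, Complex.re_sum]
  refine Finset.sum_congr rfl fun i _ => ?_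
  rw [inner_smul_right, ← inner_conj_symm ξ (φ i), Complex.mul_conj, Complex.ofReal_re,
    Complex.normSq_eq_norm_sq]

theorem re_inner_sum_eigen {r : ℕ} (μ : ℕ → ℝ≥0) (v : Fin r → H) (ξ : H) :
    (inner ℂ ξ (∑ i : Fin r, ((μ i : ℝ) : ℂ) • inner ℂ (v i) ξ • v i)).re
      = ∑ i : Fin r, (μ i : ℝ) * ‖inner ℂ (v i) ξ‖ ^ 2 := by
  rw [inner_sum, Complex.re_sum]
  refine Finset.sum_congr rfl fun i _ => ?_
  rw [inner_smul_right, inner_smul_right, ← inner_conj_symm ξ (v i), Complex.mul_conj,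
    Complex.re_ofReal_mul, Complex.ofReal_re, Complex.normSq_eq_norm_sq]

/-- If the quadratic form of `A` is at most that of `A'` on a subspace given by `p` linear
conditions, then the eigenvalues satisfy `μ (i + p) ≤ μ' i`. -/
theorem IsEigenvalueSeq.le_of_codim {A A' : H →L[ℂ] H} {μ μ' : ℕ → ℝ≥0}
    (h : IsEigenvalueSeq A μ) (h' : IsEigenvalueSeq A' μ') {p : ℕ} (g : Fin p → H)
    (hle : ∀ ξ, (∀ a, inner ℂ (g a) ξ = 0) → (inner ℂ ξ (A ξ)).re ≤ (inner ℂ ξ (A' ξ)).re)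
    (i : ℕ) : μ (i + p) ≤ μ' i := by
  obtain ⟨hμ, r, v, hv, h0, hA⟩ := h
  obtain ⟨hμ', r', v', hv', h0', hA'⟩ := h'
  by_cases hr : r ≤ i + p
  · simp [h0 _ hr]
  push Not at hr
  -- Dimension count: combinations of the first i + p + 1 eigenvectors of A, subject to p conditions
  -- from `g` and to orthogonality to the first i eigenvectors of A', contain some ξ ≠ 0. On it the
  -- form of A is at least μ (i + p) ‖ξ‖², and that of A' at most μ' i ‖ξ‖².
  let d : (Fin (i + p + 1) → ℂ) →ₗ[ℂ] (Fin r → ℂ) :=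
    { toFun := fun c b => if hb : (b : ℕ) < i + p + 1 then c ⟨b, hb⟩ else 0
      map_add' := by
        intro x y
        ext b
        by_cases hb : (b : ℕ) < i + p + 1 <;>
          simp only [Pi.add_apply, hb, dite_true, dite_false, add_zero]
      map_smul' := by
        intro x y
        ext b
        by_cases hb : (b : ℕ) < i + p + 1 <;>
          simp only [Pi.smul_apply, hb, dite_true, dite_false, smul_zero, RingHom.id_apply] }
  let s : (Fin r → ℂ) →ₗ[ℂ] H := Fintype.linearCombination ℂ v
  let T : H →ₗ[ℂ] ((Fin i ⊕ Fin p) → ℂ) :=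
    LinearMap.pi (Sum.elim
      (fun l : Fin i => if hl : (l : ℕ) < r' then (innerSL ℂ (v' ⟨l, hl⟩)).toLinearMap else 0)
      (fun a => (innerSL ℂ (g a)).toLinearMap))
  have hker : LinearMap.ker (T ∘ₗ s ∘ₗ d) ≠ ⊥ := by
    apply LinearMap.ker_ne_bot_of_finrank_lt
    simp
  obtain ⟨c, hc, hc0⟩ := Submodule.exists_mem_ne_zero_of_ne_bot hker
  rw [LinearMap.mem_ker, LinearMap.comp_apply, LinearMap.comp_apply] at hc
  set ξ := s (d c) with hξ
  have hvξ : ∀ b, inner ℂ (v b) ξ = d c b := by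
    intro b
    rw [hξ]
    simp only [s, Fintype.linearCombination_apply]
    exact hv.inner_right_fintype _ _
  have hnorm : ‖ξ‖ ^ 2 = ∑ b, ‖d c b‖ ^ 2 := by
    have h1 : inner ℂ ξ ξ = ∑ b, d c b * (starRingEnd ℂ) (d c b) := by
      conv_lhs => rw [hξ]
      simp only [s, Fintype.linearCombination_apply, sum_inner, inner_smul_left]
      refine Finset.sum_congr rfl fun b _ => ?_
      have := hvξ b
      simp only [hξ, s, Fintype.linearCombination_apply] at this
      rw [this, mul_comm]
    rw [inner_self_eq_norm_sq_to_K] at h1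
    have h2 := congrArg Complex.re h1
    simp only [Complex.mul_conj, Complex.re_sum, Complex.ofReal_re,
      Complex.normSq_eq_norm_sq] at h2
    rw [← h2]
    norm_cast
  have hpos : 0 < ‖ξ‖ ^ 2 := by
    rw [hnorm]
    obtain ⟨a, ha⟩ : ∃ a, c a ≠ 0 := by
      by_contra hcon; push Not at hcon; exact hc0 (funext hcon)
    have hda : d c ⟨a, by omega⟩ = c a := dif_pos a.isLt
    refine Finset.sum_pos' (fun _ _ => by positivity) ⟨⟨a, by omega⟩, Finset.mem_univ _, ?_⟩
    rw [hda]; positivity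
  have hlow : (μ (i + p) : ℝ) * ‖ξ‖ ^ 2 ≤ (inner ℂ ξ (A ξ)).re := by
    rw [hA, re_inner_sum_eigen, hnorm, Finset.mul_sum]
    refine Finset.sum_le_sum fun b _ => ?_
    rw [hvξ]
    by_cases hb : (b : ℕ) < i + p + 1
    · have : μ (i + p) ≤ μ b := hμ (by omega)
      gcongr
    · have : d c b = 0 := dif_neg hb
      simp [this]
  have hup : (inner ℂ ξ (A' ξ)).re ≤ (μ' i : ℝ) * ‖ξ‖ ^ 2 := by
    rw [hA', re_inner_sum_eigen]
    have hb := hv'.sum_inner_products_le (s := Finset.univ) (x := ξ)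
    refine le_trans ?_ (mul_le_mul_of_nonneg_left hb (NNReal.coe_nonneg _))
    rw [Finset.mul_sum]
    refine Finset.sum_le_sum fun l _ => ?_
    by_cases hl : (l : ℕ) < i
    · have := congrFun hc (Sum.inl ⟨l, hl⟩)
      simp only [T, LinearMap.pi_apply, Sum.elim_inl, Fin.is_lt, dite_true, Fin.eta] at this
      have h3 : inner ℂ (v' l) ξ = 0 := this
      simp [h3]
    · have : μ' l ≤ μ' i := hμ' (by omega)
      gcongr
  have hmid := hle ξ (fun a => by
    have := congrFun hc (Sum.inr a)
    exact this)
  have := hlow.trans (hmid.trans hup)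
  exact_mod_cast le_of_mul_le_mul_right this hpos

theorem IsEigenvalueSeq.unique {A : H →L[ℂ] H} {μ μ' : ℕ → ℝ≥0}
    (h : IsEigenvalueSeq A μ) (h' : IsEigenvalueSeq A μ') : μ = μ' :=
  funext fun i => le_antisymm
    (h.le_of_codim h' (p := 0) Fin.elim0 (fun _ _ => le_rfl) i)
    (h'.le_of_codim h (p := 0) Fin.elim0 (fun _ _ => le_rfl) i)

theorem zeroExt_antitone {m : ℕ} {μ : Fin m → ℝ≥0} (hμ : Antitone μ) : Antitone (zeroExt μ) := by
  intro a b hab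
  unfold zeroExt
  split_ifs with h1 h2
  · exact hμ hab
  · omega
  · positivity
  · exact le_rfl

theorem zeroExt_val {m : ℕ} (μ : Fin m → ℝ≥0) (i : Fin m) : zeroExt μ i = μ i := by
  simp [zeroExt]

open Polynomial in
/-- The nonzero eigenvalues of a frame operator are those of the Gram matrix. -/
theorem isEigenvalueSeq_frameOp {m : ℕ} (φ : Fin m → H) {μ : Fin m → ℝ≥0} (hμ : Antitone μ)
    (hchar : (Matrix.gram ℂ φ).charpoly = ∏ i, (X - C ((μ i : ℝ) : ℂ))) :
    IsEigenvalueSeq (frameOp φ) (zeroExt μ) := by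
  obtain ⟨ν, w, hν, hw, hνc⟩ := exists_antitone_eigenvalues (Matrix.isHermitian_gram ℂ φ)
  have hνμ : ν = fun i => (μ i : ℝ) :=
    antitone_eq_of_prod_X_sub_C_eq (𝕜 := ℂ) hν (fun a b hab => by exact_mod_cast hμ hab)
      (hνc.symm.trans hchar)
  subst hνμ
  -- Φ is the synthesis map: Φ*Φ is the Gram matrix and ΦΦ* the frame operator. So Φ sends an
  -- eigenbasis of the Gram matrix to orthogonal vectors of squared norm μ i, which diagonalize the
  -- frame operator.
  let Φ : EuclideanSpace ℂ (Fin m) →ₗ[ℂ] H :=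
    (Fintype.linearCombination ℂ φ) ∘ₗ (WithLp.linearEquiv 2 ℂ (Fin m → ℂ)).toLinearMap
  have hΦ : ∀ c, Φ c = ∑ i, c i • φ i := fun c => by
    simp [Φ, Fintype.linearCombination_apply]
  have hadj : ∀ c ξ, inner ℂ (Φ c) ξ
      = inner ℂ c (WithLp.toLp 2 (fun a => inner ℂ (φ a) ξ) : EuclideanSpace ℂ (Fin m)) := by
    intro c ξ
    rw [hΦ, sum_inner, PiLp.inner_apply]
    refine Finset.sum_congr rfl fun a _ => ?_
    rw [inner_smul_left]
    simp [mul_comm]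
  have hgram : ∀ c, (WithLp.toLp 2 (fun a => inner ℂ (φ a) (Φ c)) : EuclideanSpace ℂ (Fin m))
      = Matrix.toEuclideanLin (Matrix.gram ℂ φ) c := by
    intro c
    ext a
    simp only [hΦ, inner_sum, inner_smul_right, Matrix.toLpLin_apply, Matrix.mulVec,
      dotProduct, Matrix.gram_apply]
    exact Finset.sum_congr rfl fun b _ => mul_comm _ _
  have hΦw : ∀ i j, inner ℂ (Φ (w i)) (Φ (w j)) = if i = j then ((μ i : ℝ) : ℂ) else 0 := by
    intro i j
    rw [hadj, hgram, hw, inner_smul_right, orthonormal_iff_ite.mp w.orthonormal]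
    split_ifs with h <;> simp [h]
  have hframe : ∀ ξ, frameOp φ ξ = ∑ i, inner ℂ (Φ (w i)) ξ • Φ (w i) := by
    intro ξ
    simp only [hadj]
    rw [frameOp_apply]
    simp only [← map_smul]
    rw [← map_sum, w.sum_repr' (WithLp.toLp 2 (fun a => inner ℂ (φ a) ξ)), hΦ]
  -- Only images with nonzero eigenvalue can be normalized. As μ decreases, these are the indices
  -- below the first zero r.
  have hex : ∃ r, zeroExt μ r = 0 := ⟨m, by simp [zeroExt]⟩
  classical
  set r := Nat.find hex with hr
  have hrm : r ≤ m := Nat.find_min' hex (by simp [zeroExt])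
  have hlt : ∀ i < r, zeroExt μ i ≠ 0 := fun i hi => Nat.find_min hex hi
  have hge : ∀ i, r ≤ i → zeroExt μ i = 0 := fun i hi =>
    le_antisymm ((zeroExt_antitone hμ hi).trans (Nat.find_spec hex).le) (by positivity)
  have hsq : ∀ i : Fin r, ((Real.sqrt (μ (Fin.castLE hrm i)) : ℝ) : ℂ) ≠ 0 := by
    intro i
    have := hlt i i.isLt
    have h2 := zeroExt_val μ (Fin.castLE hrm i)
    simp only [Fin.val_castLE] at h2
    rw [h2] at this
    have h3 : (0 : ℝ) < μ (Fin.castLE hrm i) := by exact_mod_cast pos_iff_ne_zero.mpr this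
    exact_mod_cast (Real.sqrt_pos.mpr h3).ne'
  have hsqsq : ∀ i : Fin m, ((Real.sqrt (μ i) : ℝ) : ℂ) * ((Real.sqrt (μ i) : ℝ) : ℂ)
      = ((μ i : ℝ) : ℂ) := fun i => by
    rw [← Complex.ofReal_mul, Real.mul_self_sqrt (NNReal.coe_nonneg _)]
  refine ⟨zeroExt_antitone hμ, r,
    fun i => ((Real.sqrt (μ (Fin.castLE hrm i)) : ℝ) : ℂ)⁻¹ • Φ (w (Fin.castLE hrm i)), ?_, hge, ?_⟩
  · rw [orthonormal_iff_ite]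
    intro i j
    rw [inner_smul_left, inner_smul_right, hΦw]
    by_cases hij : i = j
    · subst hij
      simp only [if_true]
      rw [map_inv₀, Complex.conj_ofReal, ← hsqsq]
      have := hsq i
      field_simp
    · have : Fin.castLE hrm i ≠ Fin.castLE hrm j := fun h => hij (Fin.castLE_injective hrm h)
      simp [hij, this]
  · intro ξ
    rw [hframe]
    have hz : ∀ i : Fin m, r ≤ (i : ℕ) → Φ (w i) = 0 := by
      intro i hi
      have h1 := hge i hi
      rw [zeroExt_val] at h1
      have h2 := hΦw i i
      rw [if_pos rfl, h1] at h2
      simpa using h2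
    have e1 : ∑ i : Fin m, inner ℂ (Φ (w i)) ξ • Φ (w i)
        = ∑ i ∈ Finset.range m, (if h : i < m then
            inner ℂ (Φ (w ⟨i, h⟩)) ξ • Φ (w ⟨i, h⟩) else 0) := by
      rw [← Fin.sum_univ_eq_sum_range (fun i => if h : i < m then
            inner ℂ (Φ (w ⟨i, h⟩)) ξ • Φ (w ⟨i, h⟩) else 0) m]
      simp
    rw [e1, ← Finset.sum_subset (Finset.range_mono hrm), ← Fin.sum_univ_eq_sum_range
      (fun i => if h : i < m then inner ℂ (Φ (w ⟨i, h⟩)) ξ • Φ (w ⟨i, h⟩) else 0) r]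
    · refine Finset.sum_congr rfl fun i _ => ?_
      have him : (i : ℕ) < m := i.isLt.trans_le hrm
      rw [dif_pos him]
      have h2 : zeroExt μ i = μ (Fin.castLE hrm i) := zeroExt_val μ (Fin.castLE hrm i)
      rw [h2, inner_smul_left, smul_smul, smul_smul, ← hsqsq, map_inv₀, Complex.conj_ofReal]
      have := hsq i
      have hi : (⟨i, him⟩ : Fin m) = Fin.castLE hrm i := rfl
      rw [hi]
      congr 1
      field_simp
    · intro i hi hi'
      simp only [Finset.mem_range] at hi hi'
      rw [dif_pos hi, hz ⟨i, hi⟩ (by simpa using hi'), smul_zero]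

open Polynomial in
/-- The eigenvalues of a Gram matrix form a decreasing sequence of nonnegative numbers. -/
theorem exists_charpoly_gram {m : ℕ} (φ : Fin m → H) : ∃ μ : Fin m → ℝ≥0, Antitone μ ∧
    (Matrix.gram ℂ φ).charpoly = ∏ i, (X - C ((μ i : ℝ) : ℂ)) := by
  obtain ⟨ν, w, hν, hw, hνc⟩ := exists_antitone_eigenvalues (Matrix.isHermitian_gram ℂ φ)
  have hpos : ∀ i, 0 ≤ ν i := by
    intro i
    have h1 := (Matrix.posSemidef_gram ℂ φ).re_dotProduct_nonneg (w i)
    have h2 : (Matrix.gram ℂ φ).mulVec (w i) = fun a => ((ν i : ℝ) : ℂ) * w i a := by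
      have h3 := congrArg (fun z : EuclideanSpace ℂ (Fin m) => WithLp.ofLp z) (hw i)
      ext a
      exact congrFun h3 a
    rw [h2] at h1
    have h4 : dotProduct (star (WithLp.ofLp (w i))) (fun a => ((ν i : ℝ) : ℂ) * w i a)
        = ((ν i * ∑ a, ‖w i a‖ ^ 2 : ℝ) : ℂ) := by
      simp only [dotProduct, Pi.star_apply]
      push_cast
      rw [Finset.mul_sum]
      refine Finset.sum_congr rfl fun a _ => ?_
      rw [← Complex.conj_mul']
      simp
      ring
    rw [h4, ← EuclideanSpace.norm_sq_eq, w.norm_eq_one] at h1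
    simpa using h1
  exact ⟨fun i => ⟨ν i, hpos i⟩, fun a b hab => hν hab, hνc⟩

open Polynomial in
/-- The trace of the Gram matrix is the sum of its eigenvalues. -/
theorem sum_norm_sq_of_charpoly_gram {m : ℕ} (φ : Fin m → H) {μ : Fin m → ℝ≥0}
    (hchar : (Matrix.gram ℂ φ).charpoly = ∏ i, (X - C ((μ i : ℝ) : ℂ))) :
    ∑ i, ‖φ i‖ ^ 2 = ∑ i, (μ i : ℝ) := by
  have h1 := Matrix.trace_eq_sum_roots_charpoly (Matrix.gram ℂ φ)
  rw [hchar, Polynomial.roots_prod _ _ (by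
      simp [Finset.prod_ne_zero_iff, Polynomial.X_sub_C_ne_zero])] at h1
  simp only [Polynomial.roots_X_sub_C, Multiset.bind_singleton, Matrix.trace, Matrix.diag,
    Matrix.gram_apply, inner_self_eq_norm_sq_to_K] at h1
  have h2 : ((∑ i, ‖φ i‖ ^ 2 : ℝ) : ℂ) = ((∑ i, (μ i : ℝ) : ℝ) : ℂ) := by
    push_cast
    exact h1
  exact_mod_cast h2

end SpectralTheory

/-! ### Symmetric matrices with prescribed interlacing spectra -/

section InverseInterlacing

open Polynomial

/-- The polynomial `(X - c) ∏ (X - μᵢ) - ∑ᵢ aᵢ ∏_{k ≠ i} (X - μₖ)`; for `aᵢ = bᵢ²` it is the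
characteristic polynomial of the bordered diagonal matrix. -/
def borderedPoly {m : ℕ} (μ a : Fin m → ℝ) (c : ℝ) : ℝ[X] :=
  (X - C c) * ∏ i, (X - C (μ i)) - ∑ i, C (a i) * ∏ k ∈ Finset.univ.erase i, (X - C (μ k))

/-- Both polynomials are monic of degree m + 1, and the choice of c matches the next coefficient, so
their difference has degree below m. It then suffices to agree at the m distinct points μ i, which
forces a i = -P i / Q i. Interlacing makes this quotient nonnegative. -/
theorem exists_borderedPoly_of_strict {m : ℕ} {μ : Fin m → ℝ} {l : Fin (m + 1) → ℝ}
    (h1 : ∀ i, μ i < l i.castSucc) (h2 : ∀ i, l i.succ < μ i) :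
    ∃ (a : Fin m → ℝ) (c : ℝ), (∀ i, 0 ≤ a i) ∧ borderedPoly μ a c = ∏ i, (X - C (l i)) := by
  have hl : StrictAnti l := Fin.strictAnti_iff_succ_lt.mpr fun i => (h2 i).trans (h1 i)
  have hμ : StrictAnti μ := by
    intro i j hij
    have : l j.castSucc ≤ l i.succ := hl.antitone (by
      rw [Fin.le_def]; simp only [Fin.val_succ, Fin.val_castSucc]; exact hij)
    linarith [h1 j, h2 i]
  let Q : Fin m → ℝ := fun i => ∏ k ∈ Finset.univ.erase i, (μ i - μ k)
  let P : Fin m → ℝ := fun i => ∏ k, (μ i - l k)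
  have hQ : ∀ i, Q i ≠ 0 := fun i => Finset.prod_ne_zero_iff.mpr fun k hk =>
    sub_ne_zero.mpr (hμ.injective.ne (Finset.ne_of_mem_erase hk).symm)
  have hPQ : ∀ i, P i * Q i ≤ 0 := by
    intro i
    -- Apart from the two neighbours of μ i, each remaining l is paired with the μ k lying on the
    -- same side of μ i, so every pair contributes a nonnegative factor.
    have e : P i * Q i = (μ i - l i.succ) * (μ i - l i.castSucc) *
        ∏ k ∈ Finset.univ.erase i, ((μ i - l (i.succ.succAbove k)) * (μ i - μ k)) := by
      simp only [P, Q]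
      rw [Fin.prod_univ_succAbove _ i.succ, Finset.prod_mul_distrib,
        ← Finset.mul_prod_erase Finset.univ _ (Finset.mem_univ i),
        Fin.succAbove_of_castSucc_lt _ _ (by rw [Fin.lt_def]; simp)]
      ring
    rw [e]
    refine mul_nonpos_of_nonpos_of_nonneg
      (mul_nonpos_of_nonneg_of_nonpos (by linarith [h2 i]) (by linarith [h1 i])) ?_
    refine Finset.prod_nonneg fun k hk => ?_
    rcases lt_or_gt_of_ne (Finset.ne_of_mem_erase hk) with h | h
    · have e1 : i.succ.succAbove k = k.castSucc :=
        Fin.succAbove_of_castSucc_lt _ _ (by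
          rw [Fin.lt_def] at *; simp only [Fin.val_succ, Fin.val_castSucc]; omega)
      rw [e1]
      exact mul_nonneg_of_nonpos_of_nonpos (by linarith [h1 k, hμ h]) (by linarith [hμ h])
    · have e1 : i.succ.succAbove k = k.succ :=
        Fin.succAbove_of_le_castSucc _ _ (by
          rw [Fin.le_def]; have h : i < k := h; rw [Fin.lt_def] at h
          simp only [Fin.val_succ, Fin.val_castSucc]; omega)
      rw [e1]
      exact mul_nonneg (by linarith [h2 k, hμ h]) (by linarith [hμ h])
  refine ⟨fun i => -P i / Q i, ∑ i, l i - ∑ i, μ i, fun i => ?_, ?_⟩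
  · have : -P i / Q i = -(P i * Q i) / (Q i) ^ 2 := by have := hQ i; field_simp
    beta_reduce
    rw [this]
    exact div_nonneg (by linarith [hPQ i]) (sq_nonneg _)
  set a : Fin m → ℝ := fun i => -P i / Q i
  set c := ∑ i, l i - ∑ i, μ i with hc
  have hcons : (X - C c) * ∏ i, (X - C (μ i))
      = ∏ i : Fin (m + 1), (X - C ((Fin.cons c μ : Fin (m + 1) → ℝ) i)) := by
    rw [Fin.prod_univ_succ]; simp
  have hdeg : ((∏ i : Fin (m + 1), (X - C ((Fin.cons c μ : Fin (m + 1) → ℝ) i)))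
      - ∏ i, (X - C (l i))).degree < (m : WithBot ℕ) := by
    have hnat : ∀ f : Fin (m + 1) → ℝ, (∏ i, (X - C (f i))).natDegree = m + 1 := fun f => by
      simp
    have hnext : ∀ f : Fin (m + 1) → ℝ, (∏ i, (X - C (f i))).coeff m = -∑ i, f i := fun f => by
      have := Polynomial.prod_X_sub_C_nextCoeff (s := Finset.univ) f
      rw [Polynomial.nextCoeff_of_natDegree_pos (by rw [hnat]; omega), hnat] at this
      simpa using this
    have hlead : ∀ f : Fin (m + 1) → ℝ, (∏ i, (X - C (f i))).coeff (m + 1) = 1 := fun f => by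
      have := (Polynomial.monic_prod_X_sub_C f Finset.univ).coeff_natDegree
      rwa [hnat] at this
    rw [Polynomial.degree_lt_iff_coeff_zero]
    intro k hk
    rw [coeff_sub]
    rcases Nat.lt_or_ge (m + 1) k with h | h
    · rw [coeff_eq_zero_of_natDegree_lt (by rw [hnat]; omega),
        coeff_eq_zero_of_natDegree_lt (by rw [hnat]; omega), sub_zero]
    · rcases (by omega : k = m ∨ k = m + 1) with rfl | rfl
      · rw [hnext, hnext, Fin.sum_univ_succ]
        simp [hc]
      · rw [hlead, hlead, sub_self]
  have hdeg2 : (∑ i, C (a i) * ∏ k ∈ Finset.univ.erase i, (X - C (μ k))).degree < (m : WithBot ℕ) := by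
    rcases Nat.eq_zero_or_pos m with rfl | hm
    · simp
    refine lt_of_le_of_lt (degree_sum_le _ _) ?_
    rw [Finset.sup_lt_iff (by exact_mod_cast WithBot.bot_lt_coe m)]
    intro i _
    rw [← smul_eq_C_mul]
    refine lt_of_le_of_lt (degree_smul_le _ _) ?_
    rw [degree_prod]
    simp only [degree_X_sub_C, Finset.sum_const, Finset.card_erase_of_mem (Finset.mem_univ i),
      Finset.card_univ, Fintype.card_fin]
    rw [nsmul_one]
    exact_mod_cast Nat.sub_lt hm one_pos
  refine (show borderedPoly μ a c = ∏ i, (X - C (l i)) from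
    Polynomial.eq_of_degree_sub_lt_of_eval_finset_eq (Finset.univ.image μ) ?_ ?_)
  · rw [Finset.card_image_of_injective _ hμ.injective, Finset.card_univ, Fintype.card_fin]
    have e : borderedPoly μ a c - ∏ i, (X - C (l i))
      = ((∏ i : Fin (m + 1), (X - C ((Fin.cons c μ : Fin (m + 1) → ℝ) i)))
          - ∏ i, (X - C (l i)))
        - ∑ i, C (a i) * ∏ k ∈ Finset.univ.erase i, (X - C (μ k)) := by
      rw [borderedPoly, hcons]; ring
    rw [e]
    exact lt_of_le_of_lt (degree_sub_le _ _) (max_lt hdeg hdeg2)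
  · intro x hx
    obtain ⟨i, -, rfl⟩ := Finset.mem_image.mp hx
    rw [borderedPoly, eval_sub, eval_mul, eval_prod, eval_finsetSum,
      Finset.prod_eq_zero (Finset.mem_univ i) (by simp), mul_zero, zero_sub,
      Finset.sum_eq_single i]
    · simp only [eval_mul, eval_C, eval_prod, eval_sub, eval_X]
      change -(-P i / Q i * Q i) = P i
      rw [div_mul_cancel₀ _ (hQ i), neg_neg]
    · intro j _ hji
      rw [eval_mul, eval_prod, Finset.prod_eq_zero (Finset.mem_erase.mpr
        ⟨hji.symm, Finset.mem_univ i⟩) (by simp), mul_zero]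
    · simp

/-- A zero weight splits off a linear factor. This is what permits the removal of coincidences
between μ and l. -/
theorem borderedPoly_insertNth {m : ℕ} (μ : Fin (m + 1) → ℝ) (a : Fin m → ℝ) (c : ℝ)
    (i : Fin (m + 1)) :
    borderedPoly μ (i.insertNth 0 a) c
      = (X - C (μ i)) * borderedPoly (fun k => μ (i.succAbove k)) a c := by
  unfold borderedPoly
  rw [Fin.prod_univ_succAbove _ i, Fin.sum_univ_succAbove _ i, mul_sub, Finset.mul_sum]
  simp only [Fin.insertNth_apply_same, Fin.insertNth_apply_succAbove, map_zero, zero_mul, zero_add]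
  congr 1
  · ring
  · refine Finset.sum_congr rfl fun k _ => ?_
    have e : Finset.univ.erase (i.succAbove k)
        = insert i ((Finset.univ.erase k).map i.succAboveEmb) := by
      ext x
      rcases Fin.eq_self_or_eq_succAbove i x with rfl | ⟨y, rfl⟩
      · simp [(Fin.succAbove_ne x k).symm]
      · simp [Fin.succAbove_ne]
    rw [e, Finset.prod_insert (by simp [Fin.succAbove_ne]), Finset.prod_map]
    simp only [Fin.succAboveEmb_apply]
    ring

/-- Induction on m: if some μ i equals a neighbouring l j, deleting both leaves interlacing
sequences and the common root is restored by a zero weight. Without coincidences the interlacing is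
strict. -/
theorem exists_borderedPoly {m : ℕ} {μ : Fin m → ℝ} {l : Fin (m + 1) → ℝ}
    (h1 : ∀ i, μ i ≤ l i.castSucc) (h2 : ∀ i, l i.succ ≤ μ i) :
    ∃ (a : Fin m → ℝ) (c : ℝ), (∀ i, 0 ≤ a i) ∧ borderedPoly μ a c = ∏ i, (X - C (l i)) := by
  induction m with
  | zero => exact exists_borderedPoly_of_strict (fun i => i.elim0) (fun i => i.elim0)
  | succ m ih =>
    have hl : Antitone l := Fin.antitone_iff_succ_le.mpr fun i => (h2 i).trans (h1 i)
    have key : ∀ (i : Fin (m + 1)) (j : Fin (m + 2)), (j = i.castSucc ∨ j = i.succ) →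
        μ i = l j → ∃ (a : Fin (m + 1) → ℝ) (c : ℝ), (∀ i, 0 ≤ a i) ∧
          borderedPoly μ a c = ∏ i, (X - C (l i)) := by
      intro i j hj hij
      obtain ⟨a, c, ha, hac⟩ := ih (μ := fun k => μ (i.succAbove k))
        (l := fun k => l (j.succAbove k)) (by
          intro k
          refine (h1 _).trans (hl ?_)
          rcases hj with rfl | rfl <;>
          · simp only [Fin.le_def, Fin.succAbove, Fin.lt_def]
            split_ifs <;> simp_all <;> omega) (by
          intro k
          rcases lt_or_ge k.castSucc i with hk | hk
          · have e1 : i.succAbove k = k.castSucc := Fin.succAbove_of_castSucc_lt _ _ hk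
            rw [e1]
            refine le_trans (hl ?_) (h2 _)
            rcases hj with rfl | rfl <;>
            · simp only [Fin.le_def, Fin.succAbove, Fin.lt_def]
              split_ifs <;> simp_all
          · have e1 : i.succAbove k = k.succ := Fin.succAbove_of_le_castSucc _ _ hk
            rw [e1]
            refine le_trans (hl ?_) (h2 _)
            rw [Fin.le_def] at hk
            rcases hj with rfl | rfl <;>
            · simp only [Fin.le_def, Fin.succAbove, Fin.lt_def]
              split_ifs <;> simp_all <;> omega)
      refine ⟨i.insertNth 0 a, c, fun k => ?_, ?_⟩
      · rcases Fin.eq_self_or_eq_succAbove i k with rfl | ⟨y, rfl⟩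
        · simp
        · simpa using ha y
      · rw [borderedPoly_insertNth, hac, Fin.prod_univ_succAbove (fun k => X - C (l k)) j, hij]
    by_cases hs : (∀ i, μ i < l i.castSucc) ∧ ∀ i, l i.succ < μ i
    · exact exists_borderedPoly_of_strict hs.1 hs.2
    · rw [not_and_or] at hs
      rcases hs with hs | hs <;> push Not at hs <;> obtain ⟨i, hi⟩ := hs
      · exact key i _ (Or.inl rfl) (le_antisymm (h1 i) hi)
      · exact key i _ (Or.inr rfl) (le_antisymm hi (h2 i))

/-- The symmetric matrix `B` bordered by a vector `v` and a corner entry `c`. -/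
def border {m : ℕ} (B : Matrix (Fin m) (Fin m) ℝ) (v : Fin m → ℝ) (c : ℝ) :
    Matrix (Fin m ⊕ Unit) (Fin m ⊕ Unit) ℝ :=
  Matrix.fromBlocks B (Matrix.of fun i _ => v i) (Matrix.of fun _ i => v i)
    (Matrix.of fun _ _ => c)

theorem eq_of_eval_eq_off_finset {p q : ℝ[X]} (s : Finset ℝ)
    (h : ∀ t ∉ s, p.eval t = q.eval t) : p = q :=
  Polynomial.eq_of_infinite_eval_eq p q
    (s.finite_toSet.infinite_compl.mono fun t ht => h t ht)

/-- Away from the μ i the diagonal block of t - B is invertible, and the Schur complement computes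
the determinant. Finitely many excluded points do not matter for polynomials. -/
theorem charpoly_border_diagonal {m : ℕ} (μ b : Fin m → ℝ) (c : ℝ) :
    (border (Matrix.diagonal μ) b c).charpoly = borderedPoly μ (fun i => b i ^ 2) c := by
  refine eq_of_eval_eq_off_finset (Finset.univ.image μ) fun t ht => ?_
  have ht' : ∀ i, t - μ i ≠ 0 := fun i h =>
    ht (Finset.mem_image.mpr ⟨i, Finset.mem_univ _, (sub_eq_zero.mp h).symm⟩)
  rw [Matrix.eval_charpoly]
  have e : Matrix.scalar (Fin m ⊕ Unit) t - border (Matrix.diagonal μ) b c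
      = Matrix.fromBlocks (Matrix.diagonal fun i => t - μ i) (Matrix.of fun i _ => -b i)
        (Matrix.of fun _ i => -b i) (Matrix.of fun _ _ => t - c) := by
    ext i j
    rcases i with i | i <;> rcases j with j | j <;>
      simp [border, Matrix.diagonal_apply]
    split_ifs <;> simp
  let _ : Invertible (fun i => t - μ i) :=
    ⟨fun i => (t - μ i)⁻¹, by ext i; simp [ht' i], by ext i; simp [ht' i]⟩
  let _ := Matrix.diagonalInvertible (fun i => t - μ i)
  rw [e, Matrix.det_fromBlocks₁₁, Matrix.det_diagonal, Matrix.invOf_diagonal_eq]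
  have e2 : (⅟(fun i => t - μ i) : Fin m → ℝ) = fun i => (t - μ i)⁻¹ := rfl
  rw [e2, Matrix.det_unique]
  simp only [Matrix.sub_apply, Matrix.of_apply, Matrix.mul_apply, Matrix.diagonal_apply,
    borderedPoly, eval_sub, eval_mul, eval_X, eval_C, eval_prod, eval_finsetSum]
  rw [mul_sub, Finset.mul_sum, mul_comm]
  congr 1
  refine Finset.sum_congr rfl fun i _ => ?_
  rw [← Finset.mul_prod_erase Finset.univ (fun k => t - μ k) (Finset.mem_univ i)]
  have := ht' i
  simp
  field_simp

/-- Spectral theorem for real symmetric matrices, with sorted eigenvalues read off from the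
characteristic polynomial. -/
theorem exists_orthogonal_diagonalization {m : ℕ} {B : Matrix (Fin m) (Fin m) ℝ}
    (hB : B.IsSymm) {μ : Fin m → ℝ} (hμ : Antitone μ) (hchar : B.charpoly = ∏ i, (X - C (μ i))) :
    ∃ U : Matrix (Fin m) (Fin m) ℝ, U * U.transpose = 1 ∧ U.transpose * U = 1 ∧
      B = U * Matrix.diagonal μ * U.transpose := by
  obtain ⟨ν, w, hν, hw, hνc⟩ := exists_antitone_eigenvalues (𝕜 := ℝ) (G := B)
    (Matrix.isHermitian_iff_isSymm.mpr hB)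
  have : ν = μ := antitone_eq_of_prod_X_sub_C_eq (𝕜 := ℝ) hν hμ (hνc.symm.trans hchar)
  subst this
  let U : Matrix (Fin m) (Fin m) ℝ := Matrix.of fun i k => w k i
  have hU : U.transpose * U = 1 := by
    ext i j
    have := orthonormal_iff_ite.mp w.orthonormal i j
    rw [PiLp.inner_apply] at this
    rw [Matrix.mul_apply, Matrix.one_apply, ← this]
    refine Finset.sum_congr rfl fun k _ => ?_
    simp [U, mul_comm]
  have hU' : U * U.transpose = 1 := mul_eq_one_comm.mp hU
  have hBU : B * U = U * Matrix.diagonal ν := by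
    ext i k
    have := congrArg (fun z : EuclideanSpace ℝ (Fin m) => z i) (hw k)
    rw [Matrix.mul_diagonal, Matrix.mul_apply]
    simpa [Matrix.toLpLin_apply, Matrix.mulVec, dotProduct, U, mul_comm] using this
  exact ⟨U, hU', hU, by rw [← hBU, Matrix.mul_assoc, hU', Matrix.mul_one]⟩

/-- Conjugation by U ⊕ 1, where U diagonalizes B, reduces to a diagonal block. There the weights are
the squares of the border entries, whence v = U √a. -/
theorem exists_border {m : ℕ} {B : Matrix (Fin m) (Fin m) ℝ} (hB : B.IsSymm) {μ : Fin m → ℝ}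
    {l : Fin (m + 1) → ℝ} (h1 : ∀ i, μ i ≤ l i.castSucc) (h2 : ∀ i, l i.succ ≤ μ i)
    (hchar : B.charpoly = ∏ i, (X - C (μ i))) :
    ∃ (v : Fin m → ℝ) (c : ℝ), (border B v c).charpoly = ∏ i, (X - C (l i)) := by
  have hl : Antitone l := Fin.antitone_iff_succ_le.mpr fun i => (h2 i).trans (h1 i)
  have hμ : Antitone μ := by
    intro i j hij
    rcases hij.eq_or_lt with rfl | hij
    · exact le_rfl
    exact (h1 j).trans ((hl (by
      rw [Fin.le_def]; simp only [Fin.val_succ, Fin.val_castSucc]; exact hij)).trans (h2 i))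
  obtain ⟨a, c, ha, hac⟩ := exists_borderedPoly h1 h2
  obtain ⟨U, hU, hU', rfl⟩ := exists_orthogonal_diagonalization hB hμ hchar
  refine ⟨U.mulVec fun i => √(a i), c, ?_⟩
  have hsq : (fun i => √(a i) ^ 2) = a := funext fun i => Real.sq_sqrt (ha i)
  have h3 := charpoly_border_diagonal μ (fun i => √(a i)) c
  rw [hsq, hac] at h3
  rw [← h3]
  let W : Matrix (Fin m ⊕ Unit) (Fin m ⊕ Unit) ℝ := Matrix.fromBlocks U 0 0 1
  let W' : Matrix (Fin m ⊕ Unit) (Fin m ⊕ Unit) ℝ := Matrix.fromBlocks U.transpose 0 0 1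
  have hW : W' * W = 1 := by
    simp [W, W', Matrix.fromBlocks_multiply, hU']
  have e : border (U * Matrix.diagonal μ * U.transpose) (U.mulVec fun i => √(a i)) c
      = W * (border (Matrix.diagonal μ) (fun i => √(a i)) c * W') := by
    simp only [border, W, W', Matrix.fromBlocks_multiply, Matrix.mul_zero, Matrix.zero_mul,
      add_zero, zero_add, Matrix.mul_one, Matrix.one_mul, Matrix.mul_assoc]
    congr 1
    ext i j
    simp [Matrix.mul_apply, Matrix.mulVec, dotProduct, mul_comm]
  rw [e, Matrix.charpoly_mul_comm, Matrix.mul_assoc, hW, Matrix.mul_one]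

/-- Every triangular array of interlacing sequences consists of the eigenvalues of the leading
principal submatrices of a real symmetric matrix. -/
theorem exists_symmetric_of_interlacing (n : ℕ) (l : ℕ → ℕ → ℝ)
    (h1 : ∀ j < n, ∀ i < j, l j i ≤ l (j + 1) i) (h2 : ∀ j < n, ∀ i < j, l (j + 1) (i + 1) ≤ l j i) :
    ∃ G : ℕ → ℕ → ℝ, (∀ a b, G a b = G b a) ∧ ∀ j ≤ n,
      (Matrix.of fun a b : Fin j => G a b).charpoly = ∏ i : Fin j, (X - C (l j i)) := by
  induction n with
  | zero =>
    refine ⟨0, fun _ _ => rfl, fun j hj => ?_⟩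
    obtain rfl : j = 0 := by omega
    simp [Matrix.charpoly]
  | succ n ih =>
    obtain ⟨G, hG, hGc⟩ := ih (fun j hj => h1 j (by omega)) (fun j hj => h2 j (by omega))
    obtain ⟨v, c, hv⟩ := exists_border (B := Matrix.of fun a b : Fin n => G a b)
      (μ := fun i => l n i) (l := fun i => l (n + 1) i) (by ext a b; exact hG _ _)
      (fun i => h1 n (by omega) i i.isLt) (fun i => h2 n (by omega) i i.isLt) (hGc n le_rfl)
    -- The new column together with its corner entry: v' equals c at index n.
    let v' : ℕ → ℝ := fun a => if h : a < n then v ⟨a, h⟩ else c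
    let G' : ℕ → ℕ → ℝ := fun a b =>
      if a < n ∧ b < n then G a b else if a < n then v' a else v' b
    refine ⟨G', fun a b => ?_, fun j hj => ?_⟩
    · simp only [G', v']
      split_ifs <;> first | exact hG _ _ | rfl | omega
    · rcases Nat.lt_or_ge n j with hj' | hj'
      · obtain rfl : j = n + 1 := by omega
        let e : Fin n ⊕ Unit ≃ Fin (n + 1) := (Equiv.sumCongr (Equiv.refl (Fin n))
          (Equiv.ofUnique Unit (Fin 1))).trans finSumFinEquiv
        have he : Matrix.reindex e.symm e.symm (Matrix.of fun a b : Fin (n + 1) => G' a b)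
            = border (Matrix.of fun a b : Fin n => G a b) v c := by
          ext i j
          rcases i with i | i <;> rcases j with j | j <;> simp [e, border, G', v']
        rw [← hv, ← he, Matrix.charpoly_reindex]
      · rw [← hGc j hj']
        congr 1
        ext a b
        have ha : (a : ℕ) < n := by omega
        have hb : (b : ℕ) < n := by omega
        simp [G', ha, hb]

/-- Every admissible triangular array of nonnegative interlacing sequences is realized by the Gram
matrices of the initial segments of a sequence of vectors, the columns of `V`, for which the rows
of `V` are orthogonal. -/
theorem exists_vectors_of_interlacing (n : ℕ) (l : ℕ → ℕ → ℝ)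
    (h1 : ∀ j < n, ∀ i < j, l j i ≤ l (j + 1) i) (h2 : ∀ j < n, ∀ i < j, l (j + 1) (i + 1) ≤ l j i)
    (h0 : ∀ i < n, 0 ≤ l n i) :
    ∃ V : Fin n → Fin n → ℝ,
      (∀ j, ∀ hj : j ≤ n, (Matrix.of fun a b : Fin j =>
        ∑ i, V i (Fin.castLE hj a) * V i (Fin.castLE hj b)).charpoly
          = ∏ i : Fin j, (X - C (l j i))) ∧
      ∀ a b, ∑ j, V a j * V b j = if a = b then l n a else 0 := by
  obtain ⟨G, hG, hGc⟩ := exists_symmetric_of_interlacing n l h1 h2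
  have hanti : Antitone fun i : Fin n => l n i := by
    rcases n with _ | n
    · intro i; exact i.elim0
    · exact Fin.antitone_iff_succ_le.mpr fun i => by
        simpa using (h2 n (by omega) i i.isLt).trans (h1 n (by omega) i i.isLt)
  obtain ⟨U, hU, hU', hUG⟩ := exists_orthogonal_diagonalization
    (B := Matrix.of fun a b : Fin n => G a b) (by ext a b; exact hG _ _) hanti (hGc n le_rfl)
  have hU1 := fun a b => congrFun (congrFun hU' a) b
  have hG1 := fun a b => congrFun (congrFun hUG a) b
  -- With G = U Λ Uᵀ and V = √Λ Uᵀ one has VᵀV = G and VVᵀ = Λ.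
  refine ⟨fun i j => √(l n i) * U j i, fun j hj => ?_, fun a b => ?_⟩
  · rw [← hGc j hj]
    congr 1
    ext a b
    have := hG1 (Fin.castLE hj a) (Fin.castLE hj b)
    simp only [Matrix.of_apply, Fin.val_castLE] at this ⊢
    rw [this, Matrix.mul_apply]
    refine Finset.sum_congr rfl fun i _ => ?_
    rw [Matrix.mul_diagonal, Matrix.transpose_apply]
    have := Real.mul_self_sqrt (h0 i i.isLt)
    linear_combination (U (Fin.castLE hj a) i * U (Fin.castLE hj b) i) * this
  · have := hU1 a b
    rw [Matrix.mul_apply, Matrix.one_apply] at this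
    simp only [Matrix.transpose_apply] at this
    have e : ∑ j, √(l n a) * U j a * (√(l n b) * U j b)
        = √(l n a) * √(l n b) * ∑ j, U j a * U j b := by
      rw [Finset.mul_sum]
      exact Finset.sum_congr rfl fun _ _ => by ring
    rw [e, this]
    split_ifs with h
    · subst h
      rw [mul_one, Real.mul_self_sqrt (h0 a a.isLt)]
    · simp

end InverseInterlacing

/-! ### Measurable selection on compact sets -/

section MeasurableSelection

/-- Measurable selection from the fibers of a continuous map on a compact set: the values of
finitely many continuous functions at the lexicographically smallest point of a fiber. -/
theorem exists_measurable_lexMin (M : ℕ) : ∀ {X Y : Type} [TopologicalSpace X]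
    [TopologicalSpace Y] [T2Space Y] [SecondCountableTopology Y] [MeasurableSpace Y] [BorelSpace Y]
    {K : Set X} (_ : IsCompact K) {Φ : X → Y} (_ : Continuous Φ) {g : Fin M → X → ℝ}
    (_ : ∀ i, Continuous (g i)),
    ∃ s : Y → Fin M → ℝ, Measurable s ∧
      ∀ x₀ ∈ K, ∃ x ∈ K, Φ x = Φ x₀ ∧ ∀ i, g i x = s (Φ x₀) i := by
  induction M with
  | zero =>
    intro X Y _ _ _ _ _ _ K _ Φ _ g _
    exact ⟨fun _ => Fin.elim0, measurable_const, fun x₀ h => ⟨x₀, h, rfl, fun i => i.elim0⟩⟩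
  | succ M ih =>
    intro X Y _ _ _ _ _ _ K hK Φ hΦ g hg
    let m : Y → ℝ := fun y => sInf (g 0 '' (K ∩ Φ ⁻¹' {y}))
    have hcomp : ∀ y, IsCompact (g 0 '' (K ∩ Φ ⁻¹' {y})) := fun y =>
      (hK.inter_right (isClosed_singleton.preimage hΦ)).image (hg 0)
    have hmin : ∀ x₀ ∈ K, ∃ x ∈ K, Φ x = Φ x₀ ∧ g 0 x = m (Φ x₀) := by
      intro x₀ hx₀
      obtain ⟨x, ⟨hx, hx'⟩, hxm⟩ := (hcomp (Φ x₀)).sInf_mem ⟨_, x₀, ⟨hx₀, rfl⟩, rfl⟩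
      exact ⟨x, hx, hx', hxm⟩
    have hm : Measurable m := by
      refine measurable_of_Iic fun c => ?_
      -- Over Φ(K) a sublevel set of the fiberwise minimum is the image of a compact set, hence
      -- closed. Off Φ(K) the infimum is over the empty set and has the default value 0.
      have hset : m ⁻¹' Set.Iic c
          = Φ '' (K ∩ g 0 ⁻¹' Set.Iic c) ∪ ((Φ '' K)ᶜ ∩ {_y | (0 : ℝ) ≤ c}) := by
        ext y
        by_cases hy : y ∈ Φ '' K
        · obtain ⟨x₀, hx₀, rfl⟩ := hy
          have h1 : Φ x₀ ∉ (Φ '' K)ᶜ := fun h => h ⟨x₀, hx₀, rfl⟩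
          simp only [Set.mem_preimage, Set.mem_union, Set.mem_inter_iff, h1, false_and, or_false,
            Set.mem_Iic]
          constructor
          · intro h
            obtain ⟨x, hx, hxΦ, hxm⟩ := hmin x₀ hx₀
            exact ⟨x, ⟨hx, by simpa [hxm] using h⟩, hxΦ⟩
          · rintro ⟨x, ⟨hx, hxc⟩, hxΦ⟩
            exact (csInf_le (hcomp _).bddBelow ⟨x, ⟨hx, hxΦ⟩, rfl⟩).trans hxc
        · have h2 : K ∩ Φ ⁻¹' {y} = ∅ := by
            ext x
            simp only [Set.mem_inter_iff, Set.mem_preimage, Set.mem_singleton_iff,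
              Set.mem_empty_iff_false, iff_false, not_and]
            exact fun hx hxy => hy ⟨x, hx, hxy⟩
          have h3 : y ∉ Φ '' (K ∩ g 0 ⁻¹' Set.Iic c) := fun ⟨x, hx, hxy⟩ => hy ⟨x, hx.1, hxy⟩
          simp only [Set.mem_preimage, Set.mem_union, h3, false_or, Set.mem_inter_iff,
            Set.mem_compl_iff, hy, not_false_eq_true, true_and, Set.mem_Iic, Set.mem_ofPred_eq, m,
            h2, Set.image_empty, Real.sInf_empty]
      rw [hset]
      exact (((hK.inter_right (isClosed_Iic.preimage (hg 0))).image hΦ).isClosed.measurableSet).union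
        ((hK.image hΦ).isClosed.measurableSet.compl.inter (MeasurableSet.const _))
    -- Adjoining g 0 to Φ makes the new fibers the sets where g 0 is constant; at height m y this is
    -- the set of minimizers, on which the next function is minimized.
    obtain ⟨s, hs, hsel⟩ := ih hK (hΦ.prodMk (hg 0)) (g := fun i => g i.succ) (fun i => hg _)
    refine ⟨fun y => Fin.cons (m y) (s (y, m y)), ?_, ?_⟩
    · rw [measurable_pi_iff]
      intro i
      refine Fin.cases ?_ (fun i => ?_) i
      · simpa using hm
      · simp only [Fin.cons_succ]
        exact (measurable_pi_apply i).comp (hs.comp (measurable_id.prodMk hm))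
    · intro x₀ hx₀
      obtain ⟨x₁, hx₁, h1, h2⟩ := hmin x₀ hx₀
      obtain ⟨x, hx, h3, h4⟩ := hsel x₁ hx₁
      rw [Prod.mk.injEq] at h3
      refine ⟨x, hx, h3.1.trans h1, fun i => ?_⟩
      refine Fin.cases ?_ (fun i => ?_) i
      · simpa using h3.2.trans h2
      · simp [h4, h1, h2]

/-- A continuous map on a compact subset of `ℝ^ι` has a Borel measurable right inverse on its
image. -/
theorem exists_measurable_rightInverse {ι Y : Type} [Fintype ι]
    [TopologicalSpace Y] [T2Space Y] [SecondCountableTopology Y] [MeasurableSpace Y] [BorelSpace Y]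
    {K : Set (ι → ℝ)} (hK : IsCompact K) {Φ : (ι → ℝ) → Y} (hΦ : Continuous Φ) :
    ∃ s : Y → ι → ℝ, Measurable s ∧ ∀ x ∈ K, s (Φ x) ∈ K ∧ Φ (s (Φ x)) = Φ x := by
  let e := Fintype.equivFin ι
  -- With all coordinates as functions g, the selected values determine the point itself.
  obtain ⟨s, hs, hsel⟩ := exists_measurable_lexMin (Fintype.card ι) hK hΦ
    (g := fun i x => x (e.symm i)) (fun i => continuous_apply _)
  refine ⟨fun y i => s y (e i), measurable_pi_iff.mpr fun i => (measurable_pi_apply _).comp hs,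
    fun x hx => ?_⟩
  obtain ⟨x', hx', h1, h2⟩ := hsel x hx
  have : (fun i => s (Φ x) (e i)) = x' := by
    funext i
    rw [← h2]
    simp
  beta_reduce
  rw [this]
  exact ⟨hx', h1⟩

end MeasurableSelection

/-! ### The cube as a product of circles and as a fundamental domain -/

section Torus

local instance haarMeasureSpace : MeasureSpace UnitAddCircle := ⟨AddCircle.haarAddCircle⟩

local instance : IsProbabilityMeasure (volume : Measure UnitAddCircle) :=
  inferInstanceAs (IsProbabilityMeasure AddCircle.haarAddCircle)

theorem measurableSet_torus (k : ℕ) : MeasurableSet (torus k) := by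
  have : torus k = ⋂ i, (fun x : EuclideanSpace ℝ (Fin k) => x i) ⁻¹' Set.Ico (-(1 / 2) : ℝ) (1 / 2) := by
    ext x; simp [torus]
  rw [this]
  exact MeasurableSet.iInter fun i => measurableSet_Ico.preimage (by fun_prop)

theorem volume_torus_eq (k : ℕ) :
    (volume : Measure (torus k)) = Measure.comap Subtype.val volume := rfl

/-- The torus `[-1/2, 1/2)ᵏ` as a product of circles. -/
def torusCircleEquiv (k : ℕ) : torus k ≃ᵐ UnitAddTorus (Fin k) where
  toFun x i := (x.1 i : UnitAddCircle)
  invFun y := ⟨WithLp.toLp 2 fun i => (AddCircle.equivIco 1 (-(1 / 2)) (y i) : ℝ), fun i => by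
    have := (AddCircle.equivIco 1 (-(1 / 2) : ℝ) (y i)).2
    simp only [Set.mem_Ico] at this ⊢
    exact ⟨this.1, by linarith [this.2]⟩⟩
  left_inv x := by
    apply Subtype.ext
    ext i
    have hx := x.2 i
    simp only [Set.mem_Ico] at hx
    exact congrArg Subtype.val ((AddCircle.equivIco 1 (-(1 / 2) : ℝ)).apply_symm_apply ⟨x.1 i, by
      simp only [Set.mem_Ico]; exact ⟨hx.1, by linarith [hx.2]⟩⟩)
  right_inv y := by
    ext i
    exact (AddCircle.equivIco 1 (-(1 / 2) : ℝ)).symm_apply_apply (y i)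
  measurable_toFun := by
    refine measurable_pi_iff.mpr fun i => ?_
    exact AddCircle.measurable_mk'.comp (by fun_prop)
  measurable_invFun := by
    refine Measurable.subtype_mk ?_
    refine (MeasurableEquiv.toLp 2 (Fin k → ℝ)).measurable.comp (measurable_pi_iff.mpr fun i => ?_)
    exact measurable_subtype_coe.comp
      ((AddCircle.measurableEquivIco 1 (-(1 / 2))).measurable.comp (measurable_pi_apply i))

/-- Half-open intervals of either kind differ by a null set, and the quotient map from an interval
of length one to the circle preserves measure; the product of these maps is the claim. -/
theorem measurePreserving_torusCircleEquiv (k : ℕ) :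
    MeasurePreserving (torusCircleEquiv k) volume volume := by
  have h1 : MeasurePreserving (Subtype.val : torus k → EuclideanSpace ℝ (Fin k)) volume
      (volume.restrict (torus k)) :=
    ⟨measurable_subtype_coe, map_comap_subtype_coe (measurableSet_torus k) volume⟩
  have hpre : torus k = (MeasurableEquiv.toLp 2 (Fin k → ℝ)).symm ⁻¹'
      (Set.univ.pi fun _ => Set.Ico (-(1 / 2) : ℝ) (1 / 2)) := by
    ext x; simp [torus]
  have h2 := (EuclideanSpace.volume_preserving_symm_measurableEquiv_toLp (Fin k)).restrict_preimage
    (s := Set.univ.pi fun _ => Set.Ico (-(1 / 2) : ℝ) (1 / 2))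
    (MeasurableSet.univ_pi fun _ => measurableSet_Ico)
  rw [← hpre] at h2
  have h3 : (volume : Measure (Fin k → ℝ)).restrict
      (Set.univ.pi fun _ => Set.Ico (-(1 / 2) : ℝ) (1 / 2))
      = Measure.pi fun _ => (volume : Measure ℝ).restrict (Set.Ioc (-(1 / 2)) (-(1 / 2) + 1)) := by
    rw [volume_pi, Measure.restrict_pi_pi]
    congr 1
    funext i
    rw [show (-(1 / 2) + 1 : ℝ) = 1 / 2 by norm_num]
    exact Measure.restrict_congr_set Ico_ae_eq_Ioc
  rw [h3] at h2
  have h4 := measurePreserving_pi (fun _ : Fin k =>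
    (volume : Measure ℝ).restrict (Set.Ioc (-(1 / 2)) (-(1 / 2) + 1)))
    (fun _ : Fin k => (volume : Measure UnitAddCircle)) (fun _ => by
      have h5 := AddCircle.measurePreserving_mk 1 (-(1 / 2) : ℝ)
      have h6 : (@volume (AddCircle (1 : ℝ)) (AddCircle.measureSpace 1))
          = AddCircle.haarAddCircle := by
        rw [AddCircle.volume_eq_smul_haarAddCircle]; simp
      rw [h6] at h5
      exact h5)
  exact h4.comp (h2.comp h1)

instance instIsProbabilityMeasureTorus (k : ℕ) :
    IsProbabilityMeasure (volume : Measure (torus k)) :=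
  ⟨by
    have h := (measurePreserving_torusCircleEquiv k).measure_preimage
      (MeasurableSet.univ).nullMeasurableSet
    rw [Set.preimage_univ] at h
    rw [h, measure_univ]⟩

theorem intVec_apply {k : ℕ} (l : Fin k → ℤ) (i : Fin k) : intVec l i = l i := rfl

/-- Every point of `ℝᵏ` is uniquely the sum of a point of the torus and an integer vector. -/
def torusProdEquiv (k : ℕ) : torus k × (Fin k → ℤ) ≃ᵐ EuclideanSpace ℝ (Fin k) where
  toFun p := (p.1 : EuclideanSpace ℝ (Fin k)) + intVec p.2
  invFun y := (⟨y - intVec (fun i => ⌊y i + 1 / 2⌋), fun i => by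
      simp only [PiLp.sub_apply, intVec_apply, Set.mem_Ico]
      have h1 := Int.floor_le (y i + 1 / 2)
      have h2 := Int.lt_floor_add_one (y i + 1 / 2)
      constructor <;> linarith⟩, fun i => ⌊y i + 1 / 2⌋)
  left_inv p := by
    have h : (fun i => ⌊((p.1 : EuclideanSpace ℝ (Fin k)) + intVec p.2) i + 1 / 2⌋) = p.2 := by
      funext i
      have := p.1.2 i
      simp only [Set.mem_Ico] at this
      rw [Int.floor_eq_iff]
      simp only [PiLp.add_apply, intVec_apply]
      constructor <;> linarith
    refine Prod.ext (Subtype.ext ?_) h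
    simp only [h]
    abel
  right_inv y := by simp
  measurable_toFun := by
    refine Measurable.add (measurable_subtype_coe.comp measurable_fst) ?_
    exact (measurable_of_countable intVec).comp measurable_snd
  measurable_invFun := by
    have h : Measurable fun y : EuclideanSpace ℝ (Fin k) => fun i => ⌊y i + 1 / 2⌋ :=
      measurable_pi_iff.mpr fun i => Int.measurable_floor.comp (by fun_prop)
    refine Measurable.prodMk (Measurable.subtype_mk ?_) h
    exact measurable_id.sub ((measurable_of_countable intVec).comp h)

theorem torusProdEquiv_apply {k : ℕ} (x : torus k) (l : Fin k → ℤ) :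
    torusProdEquiv k (x, l) = (x : EuclideanSpace ℝ (Fin k)) + intVec l := rfl

/-- Cut a set according to the integer part of its points: each piece is an integer translate of a
subset of the torus, and Lebesgue measure is translation invariant. -/
theorem measurePreserving_torusProdEquiv (k : ℕ) :
    MeasurePreserving (torusProdEquiv k)
      ((volume : Measure (torus k)).prod (Measure.count : Measure (Fin k → ℤ))) volume := by
  refine ⟨(torusProdEquiv k).measurable, Measure.ext fun s hs => ?_⟩
  rw [Measure.map_apply (torusProdEquiv k).measurable hs,
    Measure.prod_apply_symm ((torusProdEquiv k).measurable hs), lintegral_count]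
  let T : (Fin k → ℤ) → Set (EuclideanSpace ℝ (Fin k)) := fun l =>
    {y | ((torusProdEquiv k).symm y).2 = l}
  have hT : ∀ l, MeasurableSet (T l) := fun l =>
    (measurable_snd.comp (torusProdEquiv k).symm.measurable) (measurableSet_singleton l)
  have hs2 : s = ⋃ l, s ∩ T l := by
    ext y; simp [T]
  conv_rhs => rw [hs2]
  rw [measure_iUnion]
  · refine tsum_congr fun l => ?_
    rw [volume_torus_eq, comap_subtype_coe_apply (measurableSet_torus k),
      ← measure_preimage_add_right volume (intVec l) (s ∩ T l)]
    congr 1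
    ext y
    simp only [Set.mem_image, Set.mem_preimage, Subtype.exists, exists_and_right, exists_eq_right,
      torusProdEquiv_apply, Set.mem_inter_iff, T, Set.mem_ofPred_eq]
    constructor
    · rintro ⟨hy, h⟩
      refine ⟨h, ?_⟩
      have := (torusProdEquiv k).symm_apply_apply (⟨y, hy⟩, l)
      rw [torusProdEquiv_apply] at this
      rw [this]
    · rintro ⟨h, h2⟩
      have h3 := (torusProdEquiv k).apply_symm_apply (y + intVec l)
      have h4 : torusProdEquiv k (((torusProdEquiv k).symm (y + intVec l)).1, l)
          = y + intVec l := by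
        have h6 : (((torusProdEquiv k).symm (y + intVec l)).1, l)
            = (torusProdEquiv k).symm (y + intVec l) := Prod.ext rfl h2.symm
        rw [h6, h3]
      rw [torusProdEquiv_apply] at h4
      have h5 := add_right_cancel h4
      exact ⟨h5 ▸ (((torusProdEquiv k).symm (y + intVec l)).1).2, h⟩
  · intro a b hab
    refine Set.disjoint_left.mpr fun y hy hy' => hab ?_
    exact hy.2.symm.trans hy'.2
  · exact fun l => hs.inter (hT l)

end Torus

/-! ### Fiberization as an isometry onto square integrable fields -/

section Fibers

variable {k : ℕ}

/-- Identities in L² hold only almost everywhere; this transfers them to all coordinates of the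
fiber at once. -/
theorem ae_torus_of_ae {p : EuclideanSpace ℝ (Fin k) → Prop} (h : ∀ᵐ y, p y) :
    ∀ᵐ x : torus k, ∀ l, p ((x : EuclideanSpace ℝ (Fin k)) + intVec l) := by
  have h1 := (measurePreserving_torusProdEquiv k).quasiMeasurePreserving.ae h
  filter_upwards [Measure.ae_ae_of_ae_prod h1] with x hx
  rwa [Measure.ae_count_iff] at hx

theorem lintegral_eq_lintegral_tsum {F : EuclideanSpace ℝ (Fin k) → ENNReal} (hF : Measurable F) :
    ∫⁻ y, F y = ∫⁻ x : torus k, ∑' l, F ((x : EuclideanSpace ℝ (Fin k)) + intVec l) := by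
  rw [← (measurePreserving_torusProdEquiv k).lintegral_comp_emb
    (torusProdEquiv k).measurableEmbedding, lintegral_prod (fun p => F (torusProdEquiv k p))
    (hF.comp (torusProdEquiv k).measurable).aemeasurable]
  simp_rw [lintegral_count]
  rfl

theorem enorm_sq_eq_tsum (φ : SeqL2 k) : ‖φ‖ₑ ^ 2 = ∑' l, ‖φ l‖ₑ ^ 2 := by
  have h := lp.hasSum_norm (p := 2) (by norm_num) φ
  simp only [ENNReal.toReal_ofNat, Real.rpow_ofNat] at h
  have h2 := ENNReal.ofReal_tsum_of_nonneg (fun l => sq_nonneg ‖φ l‖) h.summable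
  rw [h.tsum_eq] at h2
  simpa [ENNReal.ofReal_pow, ofReal_norm] using h2

theorem memℓp_two_iff {g : (Fin k → ℤ) → ℂ} : Memℓp g 2 ↔ ∑' l, ‖g l‖ₑ ^ 2 ≠ ⊤ := by
  rw [memℓp_gen_iff (by norm_num)]
  simp only [ENNReal.toReal_ofNat, Real.rpow_ofNat]
  constructor
  · intro h
    have h2 := ENNReal.ofReal_tsum_of_nonneg (fun l => sq_nonneg ‖g l‖) h
    simp only [ENNReal.ofReal_pow (norm_nonneg _), ofReal_norm] at h2
    rw [← h2]
    exact ENNReal.ofReal_ne_top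
  · intro h
    have h2 := ENNReal.summable_toReal h
    simpa using h2

theorem measurable_fourier (f : L2 k) : Measurable (𝓕 f : L2 k) :=
  (Lp.stronglyMeasurable _).measurable

theorem lintegral_enorm_sq (f : L2 k) : ∫⁻ y, ‖f y‖ₑ ^ 2 = ‖f‖ₑ ^ 2 := by
  have h := Lp.enorm_def f
  rw [eLpNorm_eq_lintegral_rpow_enorm_toReal (by norm_num) (by norm_num)] at h
  rw [h]
  simp only [ENNReal.toReal_ofNat, ENNReal.rpow_ofNat]
  rw [← ENNReal.rpow_natCast, ← ENNReal.rpow_mul]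
  norm_num

/-- The square sums of the periodized transform integrate to ‖f‖², so they are finite almost
everywhere and the default value in `fiber` occurs only on a null set. -/
theorem fiber_ae (f : L2 k) : ∀ᵐ x : torus k, ∀ l,
    fiber f x l = (𝓕 f : L2 k) ((x : EuclideanSpace ℝ (Fin k)) + intVec l) := by
  have hm : Measurable fun y => ‖(𝓕 f : L2 k) y‖ₑ ^ 2 := (measurable_fourier f).enorm.pow_const 2
  have h1 := lintegral_eq_lintegral_tsum hm
  rw [lintegral_enorm_sq] at h1
  have h2 : ∀ᵐ x : torus k,
      ∑' l, ‖(𝓕 f : L2 k) ((x : EuclideanSpace ℝ (Fin k)) + intVec l)‖ₑ ^ 2 < ⊤ := by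
    refine ae_lt_top' (AEMeasurable.tsum fun l => ?_) ?_
    · exact (hm.comp (measurable_subtype_coe.add_const _)).aemeasurable
    · rw [← h1]; simp
  filter_upwards [h2] with x hx l
  have : Memℓp (fun l : Fin k → ℤ =>
    (𝓕 f : L2 k) ((x : EuclideanSpace ℝ (Fin k)) + intVec l)) 2 := memℓp_two_iff.mpr hx.ne
  rw [fiber, dif_pos this]

/-- A field of vectors in `ℓ²` is strongly measurable if its coordinates are measurable. -/
theorem aestronglyMeasurable_of_coord {α : Type*} [MeasurableSpace α] {ν : Measure α}
    {φ : α → SeqL2 k} (h : ∀ l, AEMeasurable (fun x => φ x l) ν) : AEStronglyMeasurable φ ν := by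
  classical
  refine aestronglyMeasurable_of_tendsto_ae (Filter.atTop : Filter (Finset (Fin k → ℤ)))
    (f := fun s x => ∑ l ∈ s, lp.single 2 l (φ x l)) (fun s => ?_)
    (Filter.Eventually.of_forall fun x => lp.hasSum_single (by norm_num) (φ x))
  refine Finset.aestronglyMeasurable_fun_sum _ fun l _ => ?_
  have e : (fun x => (lp.single 2 l (φ x l) : SeqL2 k))
      = fun x => (φ x l) • (lp.single 2 l (1 : ℂ) : SeqL2 k) := by
    funext x
    rw [← lp.single_smul]
    simp
  rw [e]
  exact (h l).aestronglyMeasurable.smul_const _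

theorem inner_single_one [DecidableEq (Fin k → ℤ)] (l : Fin k → ℤ) (φ : SeqL2 k) :
    inner ℂ (lp.single 2 l (1 : ℂ) : SeqL2 k) φ = φ l := by
  rw [lp.inner_single_left]; simp

theorem aestronglyMeasurable_of_inner {α : Type*} [MeasurableSpace α] {ν : Measure α}
    {φ : α → SeqL2 k} (h : ∀ η, AEMeasurable (fun x => inner ℂ η (φ x)) ν) :
    AEStronglyMeasurable φ ν := by
  classical
  refine aestronglyMeasurable_of_coord fun l => ?_
  simpa only [inner_single_one] using h (lp.single 2 l (1 : ℂ))

theorem aestronglyMeasurable_fiber (f : L2 k) :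
    AEStronglyMeasurable (fiber f) (volume : Measure (torus k)) := by
  refine aestronglyMeasurable_of_coord fun l => ?_
  refine AEMeasurable.congr (f := fun x : torus k =>
    (𝓕 f : L2 k) ((x : EuclideanSpace ℝ (Fin k)) + intVec l)) ?_ ?_
  · exact ((measurable_fourier f).comp (measurable_subtype_coe.add_const _)).aemeasurable
  · filter_upwards [fiber_ae f] with x hx using (hx l).symm

theorem fiber_add (f g : L2 k) : ∀ᵐ x : torus k, fiber (f + g) x = fiber f x + fiber g x := by
  have h := ae_torus_of_ae (Lp.coeFn_add (𝓕 f : L2 k) (𝓕 g : L2 k))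
  rw [← FourierTransform.fourier_add] at h
  filter_upwards [h, fiber_ae f, fiber_ae g, fiber_ae (f + g)] with x h0 h1 h2 h3
  ext l
  rw [h3, lp.coeFn_add, Pi.add_apply, h1, h2, h0]
  rfl

theorem fiber_smul (c : ℂ) (f : L2 k) : ∀ᵐ x : torus k, fiber (c • f) x = c • fiber f x := by
  have h := ae_torus_of_ae (Lp.coeFn_smul c (𝓕 f : L2 k))
  rw [← FourierTransform.fourier_smul] at h
  filter_upwards [h, fiber_ae f, fiber_ae (c • f)] with x h0 h1 h3
  ext l
  rw [h3, lp.coeFn_smul, Pi.smul_apply, h1, h0]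
  rfl

theorem fiber_sub (f g : L2 k) : ∀ᵐ x : torus k, fiber (f - g) x = fiber f x - fiber g x := by
  have h1 := fiber_add f ((-1 : ℂ) • g)
  have h2 := fiber_smul (-1 : ℂ) g
  have e : f + (-1 : ℂ) • g = f - g := by simp [sub_eq_add_neg]
  rw [e] at h1
  filter_upwards [h1, h2] with x h1 h2
  rw [h1, h2]; simp [sub_eq_add_neg]

theorem lintegral_enorm_fiber_sq (f : L2 k) :
    ∫⁻ x : torus k, ‖fiber f x‖ₑ ^ 2 = ‖f‖ₑ ^ 2 := by
  have h1 := lintegral_eq_lintegral_tsum (F := fun y => ‖(𝓕 f : L2 k) y‖ₑ ^ 2)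
    ((measurable_fourier f).enorm.pow_const 2)
  rw [lintegral_enorm_sq] at h1
  have h3 : ‖(𝓕 f : L2 k)‖ₑ = ‖f‖ₑ := by
    rw [← ofReal_norm, Lp.norm_fourier_eq, ofReal_norm]
  rw [h3] at h1
  rw [h1]
  refine lintegral_congr_ae ?_
  filter_upwards [fiber_ae f] with x hx
  rw [enorm_sq_eq_tsum]
  simp only [hx]

theorem integrable_inner_of_lintegral {α : Type*} [MeasurableSpace α] {ν : Measure α}
    {φ ψ : α → SeqL2 k} (hφ : AEStronglyMeasurable φ ν)
    (hψ : AEStronglyMeasurable ψ ν) (h1 : ∫⁻ x, ‖φ x‖ₑ ^ 2 ∂ν ≠ ⊤) (h2 : ∫⁻ x, ‖ψ x‖ₑ ^ 2 ∂ν ≠ ⊤) :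
    Integrable (fun x => inner ℂ (φ x) (ψ x)) ν := by
  have hm : ∀ {χ : α → SeqL2 k}, AEStronglyMeasurable χ ν → ∫⁻ x, ‖χ x‖ₑ ^ 2 ∂ν ≠ ⊤ →
      MemLp χ 2 ν := by
    intro χ hχ h
    refine ⟨hχ, ?_⟩
    rw [eLpNorm_eq_lintegral_rpow_enorm_toReal (by norm_num) (by norm_num)]
    simp only [ENNReal.toReal_ofNat, ENNReal.rpow_ofNat]
    exact ENNReal.rpow_lt_top_of_nonneg (by norm_num) h
  have := L2.integrable_inner (𝕜 := ℂ) ((hm hφ h1).toLp φ) ((hm hψ h2).toLp ψ)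
  refine this.congr ?_
  filter_upwards [(hm hφ h1).coeFn_toLp, (hm hψ h2).coeFn_toLp] with x hx hy
  rw [hx, hy]

theorem integrable_inner_fiber (f g : L2 k) :
    Integrable (fun x : torus k => inner ℂ (fiber f x) (fiber g x)) volume :=
  integrable_inner_of_lintegral (aestronglyMeasurable_fiber f) (aestronglyMeasurable_fiber g)
    (by rw [lintegral_enorm_fiber_sq]; simp) (by rw [lintegral_enorm_fiber_sq]; simp)

/-- The map `f ↦ Γ f` is isometric. -/
theorem inner_eq_integral_fiber (f g : L2 k) :
    inner ℂ f g = ∫ x : torus k, inner ℂ (fiber f x) (fiber g x) := by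
  rw [← Lp.inner_fourier_eq, L2.inner_def]
  have hint := L2.integrable_inner (𝕜 := ℂ) (𝓕 f : L2 k) (𝓕 g : L2 k)
  have hmp := measurePreserving_torusProdEquiv k
  rw [← hmp.integral_comp (torusProdEquiv k).measurableEmbedding]
  have hint2 := hmp.integrable_comp_of_integrable hint
  rw [integral_prod (fun p => inner ℂ ((𝓕 f : L2 k) (torusProdEquiv k p))
    ((𝓕 g : L2 k) (torusProdEquiv k p))) hint2]
  refine integral_congr_ae ?_
  filter_upwards [fiber_ae f, fiber_ae g, hint2.prod_right_ae] with x h1 h2 h3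
  simp only [Function.comp_def] at h3
  rw [integral_countable h3, lp.inner_eq_tsum]
  simp [h1, h2, torusProdEquiv_apply]

/-- Every square integrable measurable field of vectors is the field of fibers of a function. -/
theorem exists_fiber_eq {φ : torus k → SeqL2 k} (hφ : AEStronglyMeasurable φ volume)
    (h : ∫⁻ x, ‖φ x‖ₑ ^ 2 ≠ ⊤) : ∃ f : L2 k, ∀ᵐ x, fiber f x = φ x := by
  set φ' := hφ.mk φ with hφ'
  have hφm : StronglyMeasurable φ' := hφ.stronglyMeasurable_mk
  have hcoord : ∀ l, Measurable fun x => φ' x l := by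
    classical
    intro l
    have : StronglyMeasurable fun x => inner ℂ (lp.single 2 l (1 : ℂ) : SeqL2 k) (φ' x) :=
      (stronglyMeasurable_const).inner hφm
    simpa only [inner_single_one] using this.measurable
  -- The coordinates of the field, laid out over the integer translates of the torus, form the
  -- Fourier transform of the function sought.
  let g : EuclideanSpace ℝ (Fin k) → ℂ := fun y =>
    φ' ((torusProdEquiv k).symm y).1 ((torusProdEquiv k).symm y).2
  have hg : Measurable g := by
    have h1 : Measurable fun p : torus k × (Fin k → ℤ) => φ' p.1 p.2 :=
      measurable_from_prod_countable_left hcoord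
    exact h1.comp (torusProdEquiv k).symm.measurable
  have hgx : ∀ (x : torus k) l, g ((x : EuclideanSpace ℝ (Fin k)) + intVec l) = φ' x l := by
    intro x l
    simp only [g]
    rw [← torusProdEquiv_apply, MeasurableEquiv.symm_apply_apply]
  have hgL : MemLp g 2 volume := by
    refine ⟨hg.aestronglyMeasurable, ?_⟩
    rw [eLpNorm_eq_lintegral_rpow_enorm_toReal (by norm_num) (by norm_num)]
    simp only [ENNReal.toReal_ofNat, ENNReal.rpow_ofNat]
    refine ENNReal.rpow_lt_top_of_nonneg (by norm_num) ?_
    rw [lintegral_eq_lintegral_tsum (hg.enorm.pow_const 2)]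
    simp only [hgx, ← enorm_sq_eq_tsum]
    have e : ∫⁻ x, ‖φ' x‖ₑ ^ 2 = ∫⁻ x, ‖φ x‖ₑ ^ 2 := by
      refine lintegral_congr_ae ?_
      filter_upwards [hφ.ae_eq_mk] with x hx
      rw [hx]
    rw [e]
    exact h
  refine ⟨𝓕⁻ (hgL.toLp g), ?_⟩
  have h1 := fiber_ae (𝓕⁻ (hgL.toLp g) : L2 k)
  rw [FourierTransform.fourier_fourierInv_eq] at h1
  filter_upwards [h1, ae_torus_of_ae hgL.coeFn_toLp, hφ.ae_eq_mk] with x h1 h2 h3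
  ext l
  rw [h1, h2, hgx, h3]

theorem exists_fiber_eq_of_bounded {φ : torus k → SeqL2 k} (hφ : AEStronglyMeasurable φ volume)
    {c : ℝ} (h : ∀ᵐ x, ‖φ x‖ ≤ c) : ∃ f : L2 k, ∀ᵐ x, fiber f x = φ x := by
  refine exists_fiber_eq hφ (ne_top_of_le_ne_top (b := ENNReal.ofReal c ^ 2) (by finiteness) ?_)
  calc ∫⁻ x, ‖φ x‖ₑ ^ 2 ≤ ∫⁻ _ : torus k, ENNReal.ofReal c ^ 2 := by
        refine lintegral_mono_ae ?_
        filter_upwards [h] with x hx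
        rw [← ofReal_norm]
        gcongr
    _ = ENNReal.ofReal c ^ 2 := by simp

theorem exists_fiber_eq_of_le {φ : torus k → SeqL2 k} (hφ : AEStronglyMeasurable φ volume)
    {c : ℝ} {g : L2 k} (h : ∀ᵐ x, ‖φ x‖ ≤ c * ‖fiber g x‖) : ∃ f : L2 k, ∀ᵐ x, fiber f x = φ x := by
  refine exists_fiber_eq hφ (ne_top_of_le_ne_top
    (b := ENNReal.ofReal c ^ 2 * ‖g‖ₑ ^ 2) (by finiteness) ?_)
  calc ∫⁻ x, ‖φ x‖ₑ ^ 2 ≤ ∫⁻ x : torus k, ENNReal.ofReal c ^ 2 * ‖fiber g x‖ₑ ^ 2 := by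
        refine lintegral_mono_ae ?_
        filter_upwards [h] with x hx
        rw [← mul_pow, ← ofReal_norm, ← ofReal_norm, ← ENNReal.ofReal_mul' (norm_nonneg _)]
        gcongr
    _ = _ := by
        rw [lintegral_const_mul' _ _ (by finiteness), lintegral_enorm_fiber_sq]

end Fibers

/-! ### Translations act on fibers by characters -/

section Translation

variable {k : ℕ}

attribute [local instance] haarMeasureSpace

/-- The character `y ↦ exp (-2πi ⟨l, y⟩)` of `ℝᵏ`. -/
def shiftChar (l : Fin k → ℤ) (y : EuclideanSpace ℝ (Fin k)) : ℂ :=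
  UnitAddTorus.mFourier (-l) fun i => (y i : UnitAddCircle)

theorem continuous_shiftChar (l : Fin k → ℤ) : Continuous (shiftChar l) := by
  refine (UnitAddTorus.mFourier (-l)).continuous.comp (continuous_pi fun i => ?_)
  exact (AddCircle.continuous_mk' 1).comp (by fun_prop)

theorem norm_shiftChar (l : Fin k → ℤ) (y : EuclideanSpace ℝ (Fin k)) : ‖shiftChar l y‖ = 1 := by
  simp only [shiftChar, UnitAddTorus.mFourier, ContinuousMap.coe_mk, norm_prod, fourier_apply,
    Circle.norm_coe, Finset.prod_const_one]

/-- Periodicity makes the character constant along each fiber, so a translation multiplies the whole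
fiber by one scalar. -/
theorem shiftChar_add_intVec (l m : Fin k → ℤ) (y : EuclideanSpace ℝ (Fin k)) :
    shiftChar l (y + intVec m) = shiftChar l y := by
  unfold shiftChar
  congr 1
  funext i
  rw [PiLp.add_apply, intVec_apply, AddCircle.coe_add]
  have : ((m i : ℝ) : UnitAddCircle) = 0 := by
    rw [AddCircle.coe_eq_zero_iff]
    exact ⟨m i, by simp⟩
  rw [this, add_zero]

theorem fourierChar_eq_shiftChar (l : Fin k → ℤ) (y : EuclideanSpace ℝ (Fin k)) :
    ((Real.fourierChar (-inner ℝ (intVec l) y) : Circle) : ℂ) = shiftChar l y := by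
  rw [shiftChar, UnitAddTorus.mFourier, ContinuousMap.coe_mk, Real.fourierChar_apply]
  simp only [fourier_coe_apply, ← Complex.exp_sum]
  congr 1
  rw [PiLp.inner_apply]
  push_cast
  rw [mul_neg, Finset.mul_sum, neg_mul, Finset.sum_mul, ← Finset.sum_neg_distrib]
  refine Finset.sum_congr rfl fun i _ => ?_
  simp [intVec_apply]
  ring

theorem memLp_shiftChar_mul (l : Fin k → ℤ) (g : L2 k) :
    MemLp (fun y => shiftChar l y * g y) 2 volume := by
  refine (memLp_congr_norm ?_ (Lp.aestronglyMeasurable g) ?_).mpr (Lp.memLp g)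
  · exact (continuous_shiftChar l).aestronglyMeasurable.mul (Lp.aestronglyMeasurable g)
  · filter_upwards with y
    rw [norm_mul, norm_shiftChar, one_mul]

/-- Multiplication by a character of `ℝᵏ`. -/
def modulation (l : Fin k → ℤ) : L2 k →ₗᵢ[ℂ] L2 k where
  toFun g := (memLp_shiftChar_mul l g).toLp _
  map_add' f g := by
    apply Lp.ext
    filter_upwards [(memLp_shiftChar_mul l (f + g)).coeFn_toLp,
      (memLp_shiftChar_mul l f).coeFn_toLp, (memLp_shiftChar_mul l g).coeFn_toLp,
      Lp.coeFn_add ((memLp_shiftChar_mul l f).toLp _) ((memLp_shiftChar_mul l g).toLp _),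
      Lp.coeFn_add f g] with y h1 h2 h3 h4 h5
    rw [h1, h4, Pi.add_apply, h2, h3, h5, Pi.add_apply, mul_add]
  map_smul' c f := by
    apply Lp.ext
    filter_upwards [(memLp_shiftChar_mul l (c • f)).coeFn_toLp,
      (memLp_shiftChar_mul l f).coeFn_toLp,
      Lp.coeFn_smul c ((memLp_shiftChar_mul l f).toLp _),
      Lp.coeFn_smul c f] with y h1 h2 h4 h5
    rw [h1, RingHom.id_apply, h4, Pi.smul_apply, h2, h5, Pi.smul_apply]
    simp only [smul_eq_mul]
    ring
  norm_map' f := by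
    change ‖(memLp_shiftChar_mul l f).toLp _‖ = _
    rw [Lp.norm_toLp, Lp.norm_def]
    congr 1
    refine eLpNorm_congr_norm_ae ?_
    filter_upwards with y
    rw [norm_mul, norm_shiftChar, one_mul]

theorem coeFn_modulation (l : Fin k → ℤ) (g : L2 k) :
    modulation l g =ᵐ[volume] fun y => shiftChar l y * g y :=
  (memLp_shiftChar_mul l g).coeFn_toLp

theorem fourier_schwartz_translate (l : Fin k → ℤ)
    (φ : SchwartzMap (EuclideanSpace ℝ (Fin k)) ℂ) (y : EuclideanSpace ℝ (Fin k)) :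
    (𝓕 (φ.compSubConstCLM ℂ (intVec l)) : SchwartzMap (EuclideanSpace ℝ (Fin k)) ℂ) y
      = shiftChar l y * (𝓕 φ : SchwartzMap (EuclideanSpace ℝ (Fin k)) ℂ) y := by
  rw [SchwartzMap.fourier_coe, SchwartzMap.fourier_coe, ← fourierChar_eq_shiftChar]
  have h := congrFun (VectorFourier.fourierIntegral_comp_add_right Real.fourierChar volume
    (innerₗ (EuclideanSpace ℝ (Fin k))) φ (-intVec l)) y
  rw [Circle.smul_def, smul_eq_mul] at h
  have e : (⇑φ ∘ fun v => v + -intVec l) = φ.compSubConstCLM ℂ (intVec l) := by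
    ext v
    simp [sub_eq_add_neg]
  rw [e] at h
  have e2 : (innerₗ (EuclideanSpace ℝ (Fin k))) (-intVec l) y = -inner ℝ (intVec l) y := by
    simp
  rw [e2] at h
  exact h

/-- The Fourier transform turns translations into modulations. -/
theorem fourier_shiftBy (l : Fin k → ℤ) (f : L2 k) :
    (𝓕 (shiftBy l f) : L2 k) = modulation l (𝓕 f : L2 k) := by
  have hshift : Continuous (shiftBy l : L2 k → L2 k) :=
    (Lp.isometry_compMeasurePreserving _).continuous
  have hF : Continuous fun g : L2 k => (𝓕 g : L2 k) :=
    (Lp.fourierTransformₗᵢ (EuclideanSpace ℝ (Fin k)) ℂ).continuous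
  -- Both sides are continuous in f, so Schwartz functions suffice, for which the Fourier transform
  -- is an integral.
  refine DenseRange.induction_on (p := fun f : L2 k => (𝓕 (shiftBy l f) : L2 k)
      = modulation l (𝓕 f : L2 k))
    (SchwartzMap.denseRange_toLpCLM (p := 2) (E := EuclideanSpace ℝ (Fin k)) (F := ℂ)
      (μ := volume) ENNReal.ofNat_ne_top) f ?_ ?_
  · exact isClosed_eq (hF.comp hshift) ((modulation l).continuous.comp hF)
  · intro φ
    have h1 : shiftBy l (φ.toLp 2) = (φ.compSubConstCLM ℂ (intVec l)).toLp 2 := by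
      apply Lp.ext
      have h0 : ∀ᵐ y, (φ.toLp 2 : L2 k) y = φ y := φ.coeFn_toLp 2 volume
      have h2 := (measurePreserving_sub_right (volume : Measure (EuclideanSpace ℝ (Fin k)))
        (intVec l)).quasiMeasurePreserving.ae h0
      filter_upwards [Lp.coeFn_compMeasurePreserving (φ.toLp 2)
        (measurePreserving_sub_right volume (intVec l)),
        (φ.compSubConstCLM ℂ (intVec l)).coeFn_toLp 2 volume, h2] with y h3 h4 h5
      rw [h4, shiftBy, h3, Function.comp_apply, h5]
      rfl
    rw [SchwartzMap.toLpCLM_apply, h1, SchwartzMap.toLp_fourier_eq, SchwartzMap.toLp_fourier_eq]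
    apply Lp.ext
    filter_upwards [coeFn_modulation l ((𝓕 φ : SchwartzMap _ ℂ).toLp 2),
      (𝓕 φ : SchwartzMap (EuclideanSpace ℝ (Fin k)) ℂ).coeFn_toLp 2,
      (𝓕 (φ.compSubConstCLM ℂ (intVec l)) :
        SchwartzMap (EuclideanSpace ℝ (Fin k)) ℂ).coeFn_toLp 2] with y h1 h2 h3
    rw [h1, h2, h3, fourier_schwartz_translate]

theorem fiber_shiftBy (l : Fin k → ℤ) (f : L2 k) : ∀ᵐ x : torus k,
    fiber (shiftBy l f) x = UnitAddTorus.mFourier (-l) (torusCircleEquiv k x) • fiber f x := by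
  have h := ae_torus_of_ae (coeFn_modulation l (𝓕 f : L2 k))
  rw [← fourier_shiftBy] at h
  filter_upwards [h, fiber_ae f, fiber_ae (shiftBy l f)] with x h1 h2 h3
  ext m
  rw [h3, h1, shiftChar_add_intVec, lp.coeFn_smul, Pi.smul_apply, h2]
  rfl

end Translation

/-! ### Fourier series on the torus -/

section FourierSeries

variable {k : ℕ}

attribute [local instance] haarMeasureSpace

/-- The `l`-th Fourier coefficient of a function on the torus. -/
def torusCoeff (h : torus k → ℂ) (l : Fin k → ℤ) : ℂ :=
  ∫ x : torus k, UnitAddTorus.mFourier l (torusCircleEquiv k x) * h x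

theorem torusCoeff_eq (h : torus k → ℂ) (l : Fin k → ℤ) :
    torusCoeff h l = UnitAddTorus.mFourierCoeff (fun y => h ((torusCircleEquiv k).symm y)) (-l) := by
  have hmp := measurePreserving_torusCircleEquiv k
  rw [UnitAddTorus.mFourierCoeff, ← hmp.integral_comp (torusCircleEquiv k).measurableEmbedding]
  simp [torusCoeff]

/-- The conjugate-linear first slot turns the character of index -l into that of index l, which
explains the sign convention of `torusCoeff`. -/
theorem inner_shiftBy (l : Fin k → ℤ) (f g : L2 k) :
    inner ℂ (shiftBy l f) g = torusCoeff (fun x => inner ℂ (fiber f x) (fiber g x)) l := by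
  rw [inner_eq_integral_fiber, torusCoeff]
  refine integral_congr_ae ?_
  filter_upwards [fiber_shiftBy l f] with x hx
  rw [hx, inner_smul_left, ← UnitAddTorus.mFourier_neg, neg_neg]

/-- Parseval's identity on the torus. -/
theorem hasSum_torusCoeff {h h' : torus k → ℂ} (hh : MemLp h 2 volume) (hh' : MemLp h' 2 volume) :
    HasSum (fun l => (starRingEnd ℂ) (torusCoeff h l) * torusCoeff h' l)
      (∫ x, (starRingEnd ℂ) (h x) * h' x) := by
  have hmp := measurePreserving_torusCircleEquiv k
  have hmp' := hmp.symm
  have m1 := hh.comp_measurePreserving hmp'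
  have m2 := hh'.comp_measurePreserving hmp'
  have hs := UnitAddTorus.hasSum_prod_mFourierCoeff (m1.toLp _) (m2.toLp _)
  have hc : ∀ {u : UnitAddTorus (Fin k) → ℂ} (hu : MemLp u 2 volume) l,
      UnitAddTorus.mFourierCoeff (hu.toLp u) l = UnitAddTorus.mFourierCoeff u l := by
    intro u hu l
    refine integral_congr_ae ?_
    filter_upwards [hu.coeFn_toLp] with x hx
    rw [hx]
  simp only [hc] at hs
  rw [← (Equiv.neg (Fin k → ℤ)).hasSum_iff] at hs
  convert hs using 1
  · funext l
    simp only [torusCoeff_eq, Function.comp_apply, Equiv.neg_apply]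
    rfl
  · rw [← hmp.integral_comp (torusCircleEquiv k).measurableEmbedding]
    have h1 := hmp.quasiMeasurePreserving.ae m1.coeFn_toLp
    have h2 := hmp.quasiMeasurePreserving.ae m2.coeFn_toLp
    refine integral_congr_ae ?_
    filter_upwards [h1, h2] with x h1 h2
    rw [h1, h2]
    simp

/-- An integrable function on the torus is determined by its Fourier coefficients. -/
theorem ae_eq_zero_of_torusCoeff_eq_zero {h : torus k → ℂ} (hh : Integrable h volume)
    (h0 : ∀ l, torusCoeff h l = 0) : ∀ᵐ x, h x = 0 := by
  have hmp := measurePreserving_torusCircleEquiv k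
  set u : UnitAddTorus (Fin k) → ℂ := fun y => h ((torusCircleEquiv k).symm y) with hu
  have hint : Integrable u volume := hmp.symm.integrable_comp_of_integrable hh
  -- The function is only integrable, so Parseval does not apply. Instead, density of trigonometric
  -- polynomials among continuous functions gives vanishing against every continuous φ.
  have hcont : ∀ φ : C(UnitAddTorus (Fin k), ℂ), ∫ y, φ y * u y = 0 := by
    let Λ : C(UnitAddTorus (Fin k), ℂ) →L[ℂ] ℂ := LinearMap.mkContinuous
      { toFun := fun φ => ∫ y, φ y * u y
        map_add' := fun φ ψ => by
          simp only [ContinuousMap.add_apply, add_mul]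
          exact integral_add (hint.bdd_mul φ.continuous.aestronglyMeasurable
            (Filter.Eventually.of_forall φ.norm_coe_le_norm)) (hint.bdd_mul
              ψ.continuous.aestronglyMeasurable (Filter.Eventually.of_forall ψ.norm_coe_le_norm))
        map_smul' := fun c φ => by
          simp only [ContinuousMap.smul_apply, smul_eq_mul, mul_assoc, RingHom.id_apply]
          exact integral_const_mul _ _ } (∫ y, ‖u y‖) (fun φ => by
        change ‖∫ y, φ y * u y‖ ≤ _
        refine (norm_integral_le_integral_norm _).trans ?_
        rw [mul_comm, ← integral_const_mul]
        refine integral_mono_of_nonneg (Filter.Eventually.of_forall fun _ => norm_nonneg _)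
          (hint.norm.const_mul _) (Filter.Eventually.of_forall fun y => ?_)
        beta_reduce
        rw [norm_mul]
        gcongr
        exact φ.norm_coe_le_norm y)
    have hker : (Submodule.span ℂ (Set.range UnitAddTorus.mFourier)).topologicalClosure
        ≤ LinearMap.ker (Λ : C(UnitAddTorus (Fin k), ℂ) →ₗ[ℂ] ℂ) := by
      refine Submodule.topologicalClosure_minimal _ ?_ Λ.isClosed_ker
      rw [Submodule.span_le]
      rintro _ ⟨l, rfl⟩
      have := h0 l
      rw [torusCoeff_eq, UnitAddTorus.mFourierCoeff, neg_neg] at this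
      exact this
    rw [UnitAddTorus.span_mFourier_closure_eq_top] at hker
    intro φ
    exact hker Submodule.mem_top
  have hu0 : ∀ᵐ y, u y = 0 := by
    refine ae_eq_zero_of_forall_setIntegral_isClosed_eq_zero hint fun s hs => ?_
    -- Indicators of closed sets are bounded pointwise limits of continuous functions, so integrals
    -- over closed sets vanish too.
    have hlim : Filter.Tendsto (fun n => ∫ y, ((hs.apprSeq n y : ℝ) : ℂ) * u y) Filter.atTop
        (nhds (∫ y, s.indicator u y)) := by
      refine tendsto_integral_of_dominated_convergence (fun y => ‖u y‖) (fun n => ?_) hint.norm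
        (fun n => Filter.Eventually.of_forall fun y => ?_) (Filter.Eventually.of_forall fun y => ?_)
      · refine AEStronglyMeasurable.mul (Continuous.aestronglyMeasurable ?_) hint.1
        fun_prop
      · rw [norm_mul]
        refine mul_le_of_le_one_left (norm_nonneg _) ?_
        rw [Complex.norm_real, NNReal.norm_eq]
        exact_mod_cast HasOuterApproxClosed.apprSeq_apply_le_one hs n y
      · have h1 := (tendsto_pi_nhds.mp (HasOuterApproxClosed.tendsto_apprSeq hs)) y
        have h2 : Filter.Tendsto (fun n => ((hs.apprSeq n y : ℝ) : ℂ) * u y) Filter.atTop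
            (nhds (((s.indicator (fun _ => (1 : ℝ≥0)) y : ℝ≥0) : ℝ) * u y)) := by
          refine Filter.Tendsto.mul_const _ ?_
          exact (Complex.continuous_ofReal.tendsto _).comp
            ((NNReal.continuous_coe.tendsto _).comp h1)
        convert h2 using 2
        by_cases hy : y ∈ s <;> simp [hy]
    rw [← integral_indicator hs.measurableSet]
    refine tendsto_nhds_unique hlim ?_
    have : (fun n => ∫ y, ((hs.apprSeq n y : ℝ) : ℂ) * u y) = fun _ => 0 := by
      funext n
      exact hcont ⟨fun y => ((hs.apprSeq n y : ℝ) : ℂ), by fun_prop⟩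
    rw [this]
    exact tendsto_const_nhds
  filter_upwards [hmp.quasiMeasurePreserving.ae hu0] with x hx
  simpa [hu] using hx

end FourierSeries

/-! ### The frame operator of translates, computed fiberwise -/

section FrameOperator

variable {k m : ℕ}

theorem hasSum_prod_fin {A : Type*} {f : A × Fin m → ℂ} {s : Fin m → ℂ}
    (h : ∀ i, HasSum (fun a => f (a, i)) (s i)) : HasSum f (∑ i, s i) := by
  have h1 : ∀ i ∈ Finset.univ, HasSum (fun p : A × Fin m => if p.2 = i then f p else 0) (s i) := by
    intro i _
    have hinj : Function.Injective fun a : A => (a, i) := fun a b h => (Prod.ext_iff.mp h).1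
    rw [← hinj.hasSum_iff]
    · simpa [Function.comp_def] using h i
    · rintro ⟨a, j⟩ hp
      have : j ≠ i := fun h => hp ⟨a, by rw [h]⟩
      simp [this]
  have h2 := hasSum_sum h1
  simpa using h2

theorem integral_norm_fiber_sq (u : L2 k) : ∫ x : torus k, ‖fiber u x‖ ^ 2 = ‖u‖ ^ 2 := by
  have h := inner_eq_integral_fiber u u
  simp only [inner_self_eq_norm_sq_to_K] at h
  have h2 : ((‖u‖ ^ 2 : ℝ) : ℂ) = ((∫ x : torus k, ‖fiber u x‖ ^ 2 : ℝ) : ℂ) := by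
    rw [← integral_complex_ofReal]
    push_cast
    exact h
  exact_mod_cast h2.symm

theorem integrable_norm_fiber_sq (u : L2 k) :
    Integrable (fun x : torus k => ‖fiber u x‖ ^ 2) volume := by
  have := (integrable_inner_fiber u u).re
  refine this.congr (Filter.Eventually.of_forall fun x => ?_)
  exact (norm_sq_eq_re_inner (𝕜 := ℂ) (fiber u x)).symm

theorem memLp_norm_fiber (u : L2 k) : MemLp (fun x : torus k => ‖fiber u x‖) 2 volume := by
  rw [memLp_two_iff_integrable_sq (aestronglyMeasurable_fiber u).norm]
  exact integrable_norm_fiber_sq u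

theorem aestronglyMeasurable_frameOp {α : Type*} [MeasurableSpace α] {ν : Measure α}
    {φ : α → Fin m → SeqL2 k} {ψ : α → SeqL2 k} (hφ : ∀ i, AEStronglyMeasurable (fun x => φ x i) ν)
    (hψ : AEStronglyMeasurable ψ ν) :
    AEStronglyMeasurable (fun x => frameOp (φ x) (ψ x)) ν := by
  simp only [frameOp_apply]
  exact Finset.aestronglyMeasurable_fun_sum _ fun i _ => ((hφ i).inner (𝕜 := ℂ) hψ).smul (hφ i)

variable {F : Fin m → L2 k} {c : ℝ}

theorem norm_frameOp_fiber_le (hF : ∀ i, ∀ᵐ x : torus k, ‖fiber (F i) x‖ ≤ c) :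
    ∀ᵐ x : torus k, ‖frameOp fun i => fiber (F i) x‖ ≤ m * c ^ 2 := by
  filter_upwards [ae_all_iff.mpr hF] with x hx
  refine (norm_frameOp_le _).trans ?_
  calc ∑ i, ‖fiber (F i) x‖ ^ 2 ≤ ∑ _i : Fin m, c ^ 2 := by
        gcongr with i; exact hx i
    _ = m * c ^ 2 := by simp

theorem memLp_inner_fiber {f : L2 k} (hf : ∀ᵐ x : torus k, ‖fiber f x‖ ≤ c) (u : L2 k) :
    MemLp (fun x : torus k => inner ℂ (fiber f x) (fiber u x)) 2 volume := by
  refine MemLp.of_le_mul (c := c) (memLp_norm_fiber u)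
    ((aestronglyMeasurable_fiber f).inner (aestronglyMeasurable_fiber u)) ?_
  filter_upwards [hf] with x hx
  rw [norm_norm]
  exact (norm_inner_le_norm _ _).trans (by gcongr)

/-- The bilinear form of the frame operator of a sequence of translates is computed fiberwise. -/
theorem hasSum_inner_shiftSeq (hF : ∀ i, ∀ᵐ x : torus k, ‖fiber (F i) x‖ ≤ c) (u v : L2 k) :
    HasSum (fun p => (starRingEnd ℂ) (inner ℂ (shiftSeq F p) u) * inner ℂ (shiftSeq F p) v)
      (∫ x : torus k, inner ℂ (frameOp (fun i => fiber (F i) x) (fiber u x)) (fiber v x)) := by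
  have h1 := hasSum_prod_fin (A := Fin k → ℤ)
    (f := fun p => (starRingEnd ℂ) (inner ℂ (shiftSeq F p) u) * inner ℂ (shiftSeq F p) v)
    (s := fun i => ∫ x, (starRingEnd ℂ) (inner ℂ (fiber (F i) x) (fiber u x)) *
      inner ℂ (fiber (F i) x) (fiber v x)) (fun i => by
      simp only [shiftSeq, inner_shiftBy]
      exact hasSum_torusCoeff (memLp_inner_fiber (hF i) u) (memLp_inner_fiber (hF i) v))
  convert h1 using 1
  rw [← integral_finsetSum]
  · refine integral_congr_ae (Filter.Eventually.of_forall fun x => ?_)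
    beta_reduce
    rw [frameOp_apply, sum_inner]
    exact Finset.sum_congr rfl fun i _ => inner_smul_left _ _ _
  · intro i _
    have h3 := (memLp_inner_fiber (hF i) u).star.integrable_mul (memLp_inner_fiber (hF i) v)
    exact h3

theorem summable_norm_inner_shiftSeq (hF : ∀ i, ∀ᵐ x : torus k, ‖fiber (F i) x‖ ≤ c) (u : L2 k) :
    Summable (fun p => ‖inner ℂ (shiftSeq F p) u‖ ^ 2) ∧
      ∑' p, ‖inner ℂ (shiftSeq F p) u‖ ^ 2 ≤ m * c ^ 2 * ‖u‖ ^ 2 := by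
  have h1 := (hasSum_inner_shiftSeq hF u u).mapL Complex.reCLM
  have e : (fun p => Complex.reCLM ((starRingEnd ℂ) (inner ℂ (shiftSeq F p) u) *
      inner ℂ (shiftSeq F p) u)) = fun p => ‖inner ℂ (shiftSeq F p) u‖ ^ 2 := by
    funext p
    rw [mul_comm, Complex.mul_conj, Complex.reCLM_apply, Complex.ofReal_re,
      Complex.normSq_eq_norm_sq]
  rw [e] at h1
  refine ⟨h1.summable, ?_⟩
  rw [h1.tsum_eq, Complex.reCLM_apply]
  refine (Complex.re_le_norm _).trans ((norm_integral_le_integral_norm _).trans ?_)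
  rw [← integral_norm_fiber_sq, ← integral_const_mul]
  refine integral_mono_of_nonneg (Filter.Eventually.of_forall fun _ => norm_nonneg _)
    ((integrable_norm_fiber_sq u).const_mul _) ?_
  filter_upwards [norm_frameOp_fiber_le hF] with x hx
  refine (norm_inner_le_norm _ _).trans ?_
  rw [sq ‖fiber u x‖, ← mul_assoc]
  refine mul_le_mul_of_nonneg_right ?_ (norm_nonneg (fiber u x))
  exact ((frameOp fun i => fiber (F i) x).le_opNorm (fiber u x)).trans (by gcongr)

theorem isBessel_shiftSeq (hF : ∀ i, ∀ᵐ x : torus k, ‖fiber (F i) x‖ ≤ c) :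
    IsBessel (shiftSeq F) := by
  -- The summand 1 keeps the Bessel bound positive when m or c is zero.
  refine ⟨m * c ^ 2 + 1, by positivity, fun u => ?_⟩
  obtain ⟨h1, h2⟩ := summable_norm_inner_shiftSeq hF u
  refine ⟨h1, h2.trans ?_⟩
  gcongr
  linarith

/-- The frame operator of a sequence of translates with bounded fibers exists, and acts on the
fibers as the frame operator of the fibers. -/
theorem exists_isFrameOperator (hF : ∀ i, ∀ᵐ x : torus k, ‖fiber (F i) x‖ ≤ c) :
    ∃ S : L2 k →L[ℂ] L2 k, IsFrameOperator (shiftSeq F) S ∧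
      ∀ u, ∀ᵐ x : torus k, frameOp (fun i => fiber (F i) x) (fiber u x) = fiber (S u) x := by
  classical
  have hmem : ∀ u, Memℓp (fun p => inner ℂ (shiftSeq F p) u) 2 := fun u =>
    memℓp_gen (by simpa using (summable_norm_inner_shiftSeq hF u).1)
  -- The analysis operator; its adjoint is the synthesis operator, as seen on the unit sequences.
  let A₀ : L2 k →ₗ[ℂ] lp (fun _ : (Fin k → ℤ) × Fin m => ℂ) 2 :=
    { toFun := fun u => ⟨fun p => inner ℂ (shiftSeq F p) u, hmem u⟩
      map_add' := fun u v => by ext p; exact inner_add_right _ _ _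
      map_smul' := fun a u => by ext p; exact inner_smul_right _ _ _ }
  let A : L2 k →L[ℂ] lp (fun _ : (Fin k → ℤ) × Fin m => ℂ) 2 :=
    A₀.mkContinuous (√(m * c ^ 2)) (fun u => by
      refine le_of_sq_le_sq ?_ (by positivity)
      have h := lp.norm_rpow_eq_tsum (p := 2) (by norm_num) (A₀ u)
      simp only [ENNReal.toReal_ofNat, Real.rpow_ofNat] at h
      rw [h, mul_pow, Real.sq_sqrt (by positivity)]
      exact (summable_norm_inner_shiftSeq hF u).2)
  have hA : ∀ u p, A u p = inner ℂ (shiftSeq F p) u := fun _ _ => rfl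
  have hsingle : ∀ p (a : ℂ), ContinuousLinearMap.adjoint A (lp.single 2 p a) = a • shiftSeq F p := by
    intro p a
    refine ext_inner_right ℂ fun v => ?_
    rw [ContinuousLinearMap.adjoint_inner_left, lp.inner_single_left, hA, inner_smul_left]
    simp [mul_comm]
  refine ⟨(ContinuousLinearMap.adjoint A).comp A,
    ⟨ContinuousLinearMap.adjoint A, fun a => ?_, by
      rw [ContinuousLinearMap.adjoint_adjoint]⟩, fun u => ?_⟩
  · have h := (lp.hasSum_single (p := 2) (by norm_num) a).mapL (ContinuousLinearMap.adjoint A)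
    simpa only [hsingle] using h
  · obtain ⟨w, hw⟩ := exists_fiber_eq_of_le (c := m * c ^ 2) (g := u)
      (φ := fun x => frameOp (fun i => fiber (F i) x) (fiber u x))
      (aestronglyMeasurable_frameOp (fun i => aestronglyMeasurable_fiber (F i))
        (aestronglyMeasurable_fiber u)) (by
        filter_upwards [norm_frameOp_fiber_le hF] with x hx
        exact (ContinuousLinearMap.le_opNorm _ _).trans (by gcongr))
    -- Tested against v, both vectors give the same sum over translates: one side by the definition
    -- of A, the other by fiberwise Parseval.
    have e : (ContinuousLinearMap.adjoint A).comp A u = w := by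
      refine ext_inner_right ℂ fun v => ?_
      rw [ContinuousLinearMap.comp_apply, ContinuousLinearMap.adjoint_inner_left,
        inner_eq_integral_fiber w v]
      have h1 := lp.hasSum_inner (𝕜 := ℂ) (A u) (A v)
      have h2 := hasSum_inner_shiftSeq hF u v
      have h3 : (fun p => inner ℂ (A u p) (A v p)) = fun p =>
          (starRingEnd ℂ) (inner ℂ (shiftSeq F p) u) * inner ℂ (shiftSeq F p) v := by
        funext p
        rw [hA, hA, RCLike.inner_apply, mul_comm]
      rw [h3] at h1
      rw [h1.unique h2]
      refine integral_congr_ae ?_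
      filter_upwards [hw] with x hx
      rw [hx]
    rw [e]
    filter_upwards [hw] with x hx using hx.symm

theorem IsFrameOperator.unique {H ι : Type*} [NormedAddCommGroup H] [InnerProductSpace ℂ H]
    [CompleteSpace H] {g : ι → H} {S S' : H →L[ℂ] H} (h : IsFrameOperator g S)
    (h' : IsFrameOperator g S') : S = S' := by
  obtain ⟨T, hT, rfl⟩ := h
  obtain ⟨T', hT', rfl⟩ := h'
  have : T = T' := ContinuousLinearMap.ext fun a => (hT a).unique (hT' a)
  rw [this]

/-- Constant fields of unit sequences are fibers of L² functions, since the torus has finite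
measure. The two fields therefore agree on countably many vectors off one null set, and then
everywhere by continuity. -/
theorem IsFiberField.ae_eq {S : L2 k →L[ℂ] L2 k} {s s' : torus k → SeqL2 k →L[ℂ] SeqL2 k}
    (h : IsFiberField S s) (h' : IsFiberField S s') : ∀ᵐ x, s x = s' x := by
  classical
  have h1 : ∀ l : Fin k → ℤ, ∀ᵐ x,
      s x (lp.single 2 l (1 : ℂ)) = s' x (lp.single 2 l (1 : ℂ)) := by
    intro l
    obtain ⟨f, hf⟩ := exists_fiber_eq_of_bounded (k := k)
      (φ := fun _ => (lp.single 2 l (1 : ℂ) : SeqL2 k)) aestronglyMeasurable_const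
      (c := ‖(lp.single 2 l (1 : ℂ) : SeqL2 k)‖) (Filter.Eventually.of_forall fun _ => le_rfl)
    filter_upwards [hf, h.2.2 f, h'.2.2 f] with x h1 h2 h3
    rw [← h1, h2, h3]
  filter_upwards [ae_all_iff.mpr h1] with x hx
  refine ContinuousLinearMap.ext fun φ => ?_
  have h2 := (lp.hasSum_single (p := 2) (by norm_num) φ)
  have h3 := h2.mapL (s x)
  have h4 := h2.mapL (s' x)
  have e : ∀ l, s x (lp.single 2 l (φ l)) = s' x (lp.single 2 l (φ l)) := by
    intro l
    have : (lp.single 2 l (φ l) : SeqL2 k) = φ l • (lp.single 2 l (1 : ℂ) : SeqL2 k) := by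
      rw [← lp.single_smul]; simp
    rw [this, map_smul, map_smul, hx]
  simp only [e] at h3
  exact h3.unique h4

/-- The fine spectrum is the field of spectra of the frame operators of the fibers. -/
theorem hasFineSpectrum_iff (hF : ∀ i, ∀ᵐ x : torus k, ‖fiber (F i) x‖ ≤ c)
    (μ : Fin m → torus k → ℝ≥0) : HasFineSpectrum F μ ↔ ∀ᵐ x : torus k,
      IsEigenvalueSeq (frameOp fun i => fiber (F i) x) (zeroExt fun i => μ i x) := by
  obtain ⟨S, hS, hSx⟩ := exists_isFrameOperator hF
  have hfield : IsFiberField S fun x => frameOp fun i => fiber (F i) x := by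
    refine ⟨fun ξ η => ?_, ⟨_, norm_frameOp_fiber_le hF⟩, hSx⟩
    exact (aestronglyMeasurable_const.inner (aestronglyMeasurable_frameOp
      (fun i => aestronglyMeasurable_fiber (F i)) aestronglyMeasurable_const)).aemeasurable
  constructor
  · rintro ⟨S', s, hS', hs, hμ⟩
    rw [hS'.unique hS] at hs
    filter_upwards [hs.ae_eq hfield, hμ] with x h1 h2
    rwa [← h1]
  · intro h
    exact ⟨S, _, hS, hfield, h⟩

end FrameOperator

/-! ### Measurable projections and orthonormal fields -/

section GramSchmidt

variable {H : Type*} [NormedAddCommGroup H] [InnerProductSpace ℂ H]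

open InnerProductSpace

open Classical in
theorem inner_gramSchmidtNormed {r : ℕ} (f : Fin r → H) (i j : Fin r) :
    inner ℂ (gramSchmidtNormed ℂ f i) (gramSchmidtNormed ℂ f j)
      = if i = j ∧ gramSchmidtNormed ℂ f i ≠ 0 then 1 else 0 := by
  by_cases hij : i = j
  · subst hij
    by_cases h : gramSchmidtNormed ℂ f i = 0
    · simp [h]
    · rw [inner_self_eq_norm_sq_to_K, gramSchmidtNormed_unit_length' h]
      simp [h]
  · simp [gramSchmidtNormed, gramSchmidt_orthogonal ℂ f hij, hij]

theorem span_range_gramSchmidtNormed {r : ℕ} (f : Fin r → H) :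
    Submodule.span ℂ (Set.range (gramSchmidtNormed ℂ f)) = Submodule.span ℂ (Set.range f) := by
  rw [span_gramSchmidtNormed_range, span_gramSchmidt]

/-- Vectors dependent on earlier ones are sent to zero by Gram-Schmidt and contribute nothing. The
frame operator of the result is thus the orthogonal projection onto the span, by a formula that is
measurable in the generators. -/
theorem frameOp_gramSchmidtNormed_mem {r : ℕ} (f : Fin r → H) (ξ : H) :
    frameOp (gramSchmidtNormed ℂ f) ξ ∈ Submodule.span ℂ (Set.range f) := by
  rw [frameOp_apply, ← span_range_gramSchmidtNormed]
  exact Submodule.sum_mem _ fun i _ =>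
    Submodule.smul_mem _ _ (Submodule.subset_span (Set.mem_range_self i))

theorem sub_frameOp_gramSchmidtNormed_mem {r : ℕ} (f : Fin r → H) (ξ : H) :
    ξ - frameOp (gramSchmidtNormed ℂ f) ξ ∈ (Submodule.span ℂ (Set.range f))ᗮ := by
  rw [← span_range_gramSchmidtNormed, Submodule.mem_orthogonal]
  intro u hu
  refine Submodule.span_induction ?_ (inner_zero_left _) ?_ ?_ hu
  · rintro _ ⟨j, rfl⟩
    rw [inner_sub_right, frameOp_apply, inner_sum]
    simp only [inner_smul_right, inner_gramSchmidtNormed]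
    rw [Finset.sum_eq_single j]
    · by_cases h : gramSchmidtNormed ℂ f j = 0 <;> simp [h]
    · intro i _ hij
      simp [hij.symm]
    · simp
  · intro x y _ _ hx hy
    rw [inner_add_left, hx, hy, add_zero]
  · intro a x _ hx
    rw [inner_smul_left, hx, mul_zero]

theorem norm_frameOp_gramSchmidtNormed_le {r : ℕ} (f : Fin r → H) :
    ‖frameOp (gramSchmidtNormed ℂ f)‖ ≤ r := by
  refine (norm_frameOp_le _).trans ?_
  calc ∑ i, ‖gramSchmidtNormed ℂ f i‖ ^ 2 ≤ ∑ _i : Fin r, (1 : ℝ) := by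
        gcongr with i
        by_cases h : gramSchmidtNormed ℂ f i = 0
        · simp [h]
        · simp [gramSchmidtNormed_unit_length' h]
    _ = r := by simp

theorem finrank_span_range {r : ℕ} (f : Fin r → H) [DecidablePred fun i =>
    gramSchmidtNormed ℂ f i ≠ 0] :
    Module.finrank ℂ (Submodule.span ℂ (Set.range f))
      = (Finset.univ.filter fun i => gramSchmidtNormed ℂ f i ≠ 0).card := by
  have hli := (gramSchmidtNormed_orthonormal' (𝕜 := ℂ) f).linearIndependent
  have h1 := finrank_span_eq_card hli
  have h2 : Submodule.span ℂ (Set.range fun i : {i | gramSchmidtNormed ℂ f i ≠ 0} =>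
      gramSchmidtNormed ℂ f i) = Submodule.span ℂ (Set.range f) := by
    rw [← span_range_gramSchmidtNormed]
    apply le_antisymm
    · exact Submodule.span_mono (by rintro _ ⟨i, rfl⟩; exact ⟨i, rfl⟩)
    · rw [Submodule.span_le]
      rintro _ ⟨i, rfl⟩
      by_cases h : gramSchmidtNormed ℂ f i = 0
      · rw [h]; exact Submodule.zero_mem _
      · exact Submodule.subset_span ⟨⟨i, h⟩, rfl⟩
  rw [h2] at h1
  rw [h1, ← Fintype.card_subtype]
  exact Fintype.card_congr (Equiv.refl _)

theorem stronglyMeasurable_gramSchmidtNormed {α : Type*} [MeasurableSpace α] {r : ℕ}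
    {f : α → Fin r → H} (hf : ∀ i, StronglyMeasurable fun x => f x i) (i : Fin r) :
    StronglyMeasurable fun x => gramSchmidtNormed ℂ (f x) i := by
  have h : ∀ i, StronglyMeasurable fun x => gramSchmidt ℂ (f x) i := by
    intro i
    induction i using WellFoundedLT.induction with
    | ind i ih =>
      have e : (fun x => gramSchmidt ℂ (f x) i) = fun x => f x i - ∑ j ∈ Finset.Iio i,
          (inner ℂ (gramSchmidt ℂ (f x) j) (f x i) * ((‖gramSchmidt ℂ (f x) j‖ : ℂ) ^ 2)⁻¹)
            • gramSchmidt ℂ (f x) j := by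
        funext x
        exact eq_sub_of_add_eq (gramSchmidt_def'' ℂ (f x) i).symm
      rw [e]
      refine (hf i).sub (Finset.stronglyMeasurable_fun_sum _ fun j hj => ?_)
      have hj' := ih j (Finset.mem_Iio.mp hj)
      refine StronglyMeasurable.smul (StronglyMeasurable.mul (hj'.inner (hf i)) ?_) hj'
      exact ((Complex.measurable_ofReal.comp hj'.norm.measurable).pow_const 2).inv.stronglyMeasurable
  unfold gramSchmidtNormed
  exact StronglyMeasurable.smul
    ((Complex.measurable_ofReal.comp (h i).norm.measurable).inv.stronglyMeasurable) (h i)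

/-- A measurable field of finite dimensional spaces, given by measurable generators, has a
measurable field of orthonormal bases, continued by zeros. -/
theorem exists_measurable_orthonormal {α : Type*} [MeasurableSpace α] {r : ℕ}
    {f : α → Fin r → H} (hf : ∀ i, StronglyMeasurable fun x => f x i) :
    ∃ E : ℕ → α → H, (∀ i, StronglyMeasurable (E i)) ∧
      (∀ x i, E i x ∈ Submodule.span ℂ (Set.range (f x))) ∧
      ∀ x i j, inner ℂ (E i x) (E j x)
        = if i = j ∧ i < Module.finrank ℂ (Submodule.span ℂ (Set.range (f x))) then 1 else 0 := by
  classical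
  let e : Fin r → α → H := fun i x => gramSchmidtNormed ℂ (f x) i
  have he : ∀ i, StronglyMeasurable (e i) := stronglyMeasurable_gramSchmidtNormed hf
  let s : α → Finset (Fin r) := fun x => Finset.univ.filter fun i => e i x ≠ 0
  have hs : ∀ S, MeasurableSet {x | s x = S} := by
    intro S
    have : {x | s x = S} = ⋂ i, {x | e i x ≠ 0 ↔ i ∈ S} := by
      ext x
      simp [s, Finset.ext_iff]
    rw [this]
    refine MeasurableSet.iInter fun i => ?_
    have h1 : MeasurableSet {x | e i x ≠ 0} := by
      have h2 : {x | e i x ≠ 0} = (fun x => ‖e i x‖) ⁻¹' {0}ᶜ := by ext x; simp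
      rw [h2]
      exact (he i).norm.measurable (measurableSet_singleton _).compl
    by_cases hi : i ∈ S
    · simpa [hi] using h1
    · have := h1.compl
      simpa [hi, Set.compl_def] using this
  -- The set of nonzero Gram-Schmidt vectors takes finitely many values in x. On each level set
  -- these vectors are renumbered in order, so that they occupy the indices below the dimension.
  let G : Finset (Fin r) → ℕ → α → H := fun S i x =>
    if h : i < S.card then e (S.orderEmbOfFin rfl ⟨i, h⟩) x else 0
  have hG : ∀ S i, StronglyMeasurable (G S i) := by
    intro S i
    by_cases h : i < S.card
    · simpa [G, h] using he _
    · simpa [G, h] using stronglyMeasurable_const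
  have hfin : ∀ x, Module.finrank ℂ (Submodule.span ℂ (Set.range (f x))) = (s x).card :=
    fun x => finrank_span_range (f x)
  refine ⟨fun i x => G (s x) i x, fun i => ?_, fun x i => ?_, fun x i j => ?_⟩
  · have h1 : (fun x => G (s x) i x)
        = fun x => ∑ S : Finset (Fin r), {x | s x = S}.indicator (G S i) x := by
      funext x
      rw [Finset.sum_eq_single (s x)]
      · simp
      · intro S _ hS
        rw [Set.indicator_of_notMem]
        exact fun h => hS (Eq.symm h)
      · simp
    beta_reduce
    rw [h1]
    exact Finset.stronglyMeasurable_fun_sum _ fun S _ => (hG S i).indicator (hs S)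
  · by_cases h : i < (s x).card
    · simp only [G, h, dite_true]
      rw [← span_range_gramSchmidtNormed]
      exact Submodule.subset_span ⟨_, rfl⟩
    · simp [G, h]
  · rw [hfin]
    by_cases hi : i < (s x).card
    · by_cases hj : j < (s x).card
      · simp only [G, hi, hj, dite_true, e]
        rw [inner_gramSchmidtNormed]
        have hmem := (s x).orderEmbOfFin_mem rfl ⟨i, hi⟩
        have hne : gramSchmidtNormed ℂ (f x) ((s x).orderEmbOfFin rfl ⟨i, hi⟩) ≠ 0 :=
          (Finset.mem_filter.mp hmem).2
        simp [hne]
      · have hij : i ≠ j := fun h => hj (h ▸ hi)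
        simp [G, hj, hij]
    · simp [G, hi]

end GramSchmidt

/-! ### The range function of a finitely generated shift invariant space -/

section RangeFunction

variable {k r : ℕ}

open InnerProductSpace

theorem isClosed_span_range (f : Fin r → SeqL2 k) :
    IsClosed (Submodule.span ℂ (Set.range f) : Set (SeqL2 k)) := by
  have := FiniteDimensional.span_of_finite ℂ (Set.finite_range f)
  exact Submodule.closed_of_finiteDimensional _

/-- The field of spaces spanned by the fibers of finitely many functions. -/
def fiberSpan (a : Fin r → L2 k) (x : torus k) : ClosedSubmodule ℂ (SeqL2 k) :=
  ⟨Submodule.span ℂ (Set.range fun i => fiber (a i) x), isClosed_span_range _⟩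

theorem aestronglyMeasurable_frameOp_gramSchmidt (a : Fin r → L2 k) {ψ : torus k → SeqL2 k}
    (hψ : AEStronglyMeasurable ψ volume) :
    AEStronglyMeasurable (fun x : torus k =>
      frameOp (gramSchmidtNormed ℂ fun i => fiber (a i) x) (ψ x)) volume := by
  refine aestronglyMeasurable_frameOp (fun i => ?_) hψ
  let f : torus k → Fin r → SeqL2 k := fun x i => (aestronglyMeasurable_fiber (a i)).mk _ x
  have hf := stronglyMeasurable_gramSchmidtNormed (f := f)
    (fun i => (aestronglyMeasurable_fiber (a i)).stronglyMeasurable_mk) i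
  refine ⟨_, hf, ?_⟩
  filter_upwards [ae_all_iff.mpr fun i => (aestronglyMeasurable_fiber (a i)).ae_eq_mk] with x hx
  have : (fun i => fiber (a i) x) = f x := funext hx
  rw [this]

/-- Orthogonality to all translates is the vanishing of every Fourier coefficient of an integrable
function. -/
theorem inner_shiftBy_eq_zero_iff (f h : L2 k) : (∀ l, inner ℂ (shiftBy l f) h = 0) ↔
    ∀ᵐ x : torus k, inner ℂ (fiber f x) (fiber h x) = 0 := by
  simp only [inner_shiftBy]
  refine ⟨ae_eq_zero_of_torusCoeff_eq_zero (integrable_inner_fiber f h), fun h0 l => ?_⟩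
  rw [torusCoeff, ← integral_zero (torus k) ℂ]
  refine integral_congr_ae ?_
  filter_upwards [h0] with x hx
  rw [hx, mul_zero]

theorem inner_eq_zero_of_mem_span {f : Fin r → SeqL2 k} {η ξ : SeqL2 k}
    (h : ∀ i, inner ℂ (f i) η = 0) (hξ : ξ ∈ Submodule.span ℂ (Set.range f)) :
    inner ℂ ξ η = 0 := by
  refine Submodule.span_induction ?_ (inner_zero_left _) ?_ ?_ hξ
  · rintro _ ⟨i, rfl⟩; exact h i
  · intro x y _ _ hx hy
    rw [inner_add_left, hx, hy, add_zero]
  · intro c x _ hx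
    rw [inner_smul_left, hx, mul_zero]

/-- Membership in a finitely generated shift invariant space is decided fiberwise. -/
theorem mem_shiftSpan_iff (a : Fin r → L2 k) (f : L2 k) :
    f ∈ shiftSpan (Set.range a) ↔ ∀ᵐ x : torus k, fiber f x ∈ fiberSpan a x := by
  set K : Submodule ℂ (L2 k) :=
    Submodule.span ℂ {g | ∃ f ∈ Set.range a, ∃ l : Fin k → ℤ, g = shiftBy l f} with hK
  have hperp : ∀ h : L2 k, h ∈ Kᗮ ↔ ∀ i, ∀ᵐ x : torus k,
      inner ℂ (fiber (a i) x) (fiber h x) = 0 := by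
    intro h
    simp only [← inner_shiftBy_eq_zero_iff]
    rw [Submodule.mem_orthogonal]
    constructor
    · intro hh i l
      exact hh _ (Submodule.subset_span ⟨a i, ⟨i, rfl⟩, l, rfl⟩)
    · intro hh u hu
      refine Submodule.span_induction ?_ (inner_zero_left _) ?_ ?_ hu
      · rintro _ ⟨_, ⟨i, rfl⟩, l, rfl⟩
        exact hh i l
      · intro x y _ _ hx hy
        rw [inner_add_left, hx, hy, add_zero]
      · intro c x _ hx
        rw [inner_smul_left, hx, mul_zero]
  have hmem : f ∈ shiftSpan (Set.range a) ↔ f ∈ Kᗮᗮ := by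
    rw [Submodule.orthogonal_orthogonal_eq_closure]
    rfl
  rw [hmem, Submodule.mem_orthogonal]
  constructor
  · intro hf
    -- p is the fiberwise projection of f onto the span of the fibers. Then f - p is orthogonal to
    -- all translates of the generators, hence to f, and fiberwise to p; so f = p.
    obtain ⟨p, hp⟩ := exists_fiber_eq_of_le (c := r) (g := f)
      (aestronglyMeasurable_frameOp_gramSchmidt a (aestronglyMeasurable_fiber f))
      (Filter.Eventually.of_forall fun x =>
        (ContinuousLinearMap.le_opNorm _ _).trans (mul_le_mul_of_nonneg_right
          (norm_frameOp_gramSchmidtNormed_le _) (norm_nonneg _)))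
    have hsub : ∀ᵐ x : torus k, fiber (f - p) x
        ∈ (Submodule.span ℂ (Set.range fun i => fiber (a i) x))ᗮ := by
      filter_upwards [fiber_sub f p, hp] with x h1 h2
      rw [h1, h2]
      exact sub_frameOp_gramSchmidtNormed_mem _ _
    have hK' : f - p ∈ Kᗮ := by
      rw [hperp]
      intro i
      filter_upwards [hsub] with x hx
      exact (Submodule.mem_orthogonal _ _).mp hx _ (Submodule.subset_span ⟨i, rfl⟩)
    have h1 := hf _ hK'
    have h2 : inner ℂ (f - p) p = 0 := by
      rw [inner_eq_integral_fiber, ← integral_zero (torus k) ℂ]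
      refine integral_congr_ae ?_
      filter_upwards [hsub, hp] with x h3 h4
      rw [h4]
      exact (Submodule.mem_orthogonal' _ _).mp h3 _ (frameOp_gramSchmidtNormed_mem _ _)
    have h3 : f - p = 0 := by
      rw [← inner_self_eq_zero (𝕜 := ℂ), inner_sub_right, h1, h2, sub_zero]
    have h4 : f = p := sub_eq_zero.mp h3
    rw [h4]
    filter_upwards [hp] with x hx
    rw [hx]
    exact frameOp_gramSchmidtNormed_mem _ _
  · intro hf h hh
    rw [hperp, ← ae_all_iff] at hh
    rw [inner_eq_integral_fiber, ← integral_zero (torus k) ℂ]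
    refine integral_congr_ae ?_
    filter_upwards [hf, hh] with x h1 h2
    have := inner_eq_zero_of_mem_span h2 h1
    rw [← inner_conj_symm, this, map_zero]

theorem isRangeFunction_fiberSpan (a : Fin r → L2 k) :
    IsRangeFunction (shiftSpan (Set.range a)) (fiberSpan a) := by
  refine ⟨fun ξ η => ?_, mem_shiftSpan_iff a⟩
  have e : (fun x : torus k => inner ℂ η ((fiberSpan a x).toSubmodule.starProjection ξ))
      = fun x => inner ℂ η (frameOp (gramSchmidtNormed ℂ fun i => fiber (a i) x) ξ) := by
    funext x
    rw [Submodule.eq_starProjection_of_mem_orthogonal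
      (K := (fiberSpan a x).toSubmodule) (frameOp_gramSchmidtNormed_mem _ ξ)
      (sub_frameOp_gramSchmidtNormed_mem _ ξ)]
  rw [e]
  exact (aestronglyMeasurable_const.inner
    (aestronglyMeasurable_frameOp_gramSchmidt a aestronglyMeasurable_const)).aemeasurable

theorem isRangeFunction_rangeFunction (a : Fin r → L2 k) :
    IsRangeFunction (shiftSpan (Set.range a)) (rangeFunction (shiftSpan (Set.range a))) :=
  Classical.epsilon_spec (p := IsRangeFunction (shiftSpan (Set.range a)))
    ⟨_, isRangeFunction_fiberSpan a⟩

/-- The range function of a finitely generated shift invariant space is spanned by the fibers of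
the generators. -/
theorem rangeFunction_ae_eq (a : Fin r → L2 k) : ∀ᵐ x : torus k,
    (rangeFunction (shiftSpan (Set.range a)) x).toSubmodule
      = Submodule.span ℂ (Set.range fun i => fiber (a i) x) := by
  classical
  set J := rangeFunction (shiftSpan (Set.range a)) with hJ
  have hJr : IsRangeFunction _ J := isRangeFunction_rangeFunction a
  have h1 : ∀ i, ∀ᵐ x : torus k, fiber (a i) x ∈ J x := by
    intro i
    rw [← hJr.2, mem_shiftSpan_iff]
    exact Filter.Eventually.of_forall fun x => Submodule.subset_span ⟨i, rfl⟩
  -- The projections of the unit sequences onto J x are bounded measurable fields, hence fibers of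
  -- elements of the space, which lie in the span of the generators' fibers.
  have h2 : ∀ l : Fin k → ℤ, ∀ᵐ x : torus k,
      (J x).toSubmodule.starProjection (lp.single 2 l (1 : ℂ)) ∈ fiberSpan a x := by
    intro l
    obtain ⟨f, hf⟩ := exists_fiber_eq_of_bounded
      (φ := fun x => (J x).toSubmodule.starProjection (lp.single 2 l (1 : ℂ)))
      (c := ‖(lp.single 2 l (1 : ℂ) : SeqL2 k)‖)
      (aestronglyMeasurable_of_inner fun η => hJr.1 _ η)
      (Filter.Eventually.of_forall fun x =>
        ((ContinuousLinearMap.le_opNorm _ _).trans (mul_le_of_le_one_left (norm_nonneg _)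
          (Submodule.starProjection_norm_le _))))
    have hfW : f ∈ shiftSpan (Set.range a) := by
      rw [hJr.2]
      filter_upwards [hf] with x hx
      rw [hx]
      exact Submodule.starProjection_apply_mem _ _
    filter_upwards [hf, (mem_shiftSpan_iff a f).mp hfW] with x h3 h4
    rwa [← h3]
  filter_upwards [ae_all_iff.mpr h1, ae_all_iff.mpr h2] with x h1 h2
  apply le_antisymm
  · intro ξ hξ
    have h3 := (lp.hasSum_single (p := 2) (by norm_num) ξ).mapL (J x).toSubmodule.starProjection
    rw [Submodule.starProjection_eq_self_iff.mpr hξ] at h3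
    refine (isClosed_span_range fun i => fiber (a i) x).mem_of_tendsto h3
      (Filter.Eventually.of_forall fun s => Submodule.sum_mem _ fun l _ => ?_)
    have e : (lp.single 2 l (ξ l) : SeqL2 k) = ξ l • (lp.single 2 l (1 : ℂ) : SeqL2 k) := by
      rw [← lp.single_smul]; simp
    rw [e, map_smul]
    exact Submodule.smul_mem _ _ (h2 l)
  · rw [Submodule.span_le]
    rintro _ ⟨i, rfl⟩
    exact h1 i

/-- A finitely generated shift invariant space has a measurable field of orthonormal bases of its
fiber spaces, continued by zeros. -/
theorem IsFSI.exists_orthonormal_field {W : Submodule ℂ (L2 k)} (hW : IsFSI W) :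
    ∃ E : ℕ → torus k → SeqL2 k, (∀ i, StronglyMeasurable (E i)) ∧
      (∀ᵐ x, ∀ i j, inner ℂ (E i x) (E j x) = if i = j ∧ i < fiberDim W x then 1 else 0) ∧
      ∀ f : L2 k, (∀ᵐ x, fiber f x ∈ Submodule.span ℂ (Set.range fun i => E i x)) → f ∈ W := by
  obtain ⟨A, hA, rfl⟩ := hW
  obtain ⟨r, a, ha⟩ := hA.fin_embedding
  obtain ⟨E, hE, hmem, hinner⟩ := exists_measurable_orthonormal
    (f := fun x i => (aestronglyMeasurable_fiber (a i)).mk _ x)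
    (fun i => (aestronglyMeasurable_fiber (a i)).stronglyMeasurable_mk)
  have heq : ∀ᵐ x : torus k, (fun i => (aestronglyMeasurable_fiber (a i)).mk _ x)
      = fun i => fiber (a i) x := by
    filter_upwards [ae_all_iff.mpr fun i => (aestronglyMeasurable_fiber (a i)).ae_eq_mk] with x hx
    exact funext fun i => (hx i).symm
  refine ⟨E, hE, ?_, fun f hf => ?_⟩
  · filter_upwards [heq, rangeFunction_ae_eq a] with x h1 h2 i j
    rw [hinner x i j, h1, fiberDim, ← ha, h2]
  · rw [← ha, mem_shiftSpan_iff]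
    filter_upwards [heq, hf] with x h1 h2
    refine Submodule.span_le.mpr ?_ h2
    rintro _ ⟨i, rfl⟩
    have := hmem x i
    rwa [h1] at this

end RangeFunction

/-! ### Measurable choice of eigenvalues and of vectors -/

section EigenvalueSelection

open Polynomial

/-- Values at the natural numbers encode a characteristic polynomial by countably many functions
continuous in the matrix, the form in which measurable selection uses it. -/
theorem charpoly_eq_of_det_eq {𝕜 : Type*} [RCLike 𝕜] {m : ℕ} {M : Matrix (Fin m) (Fin m) 𝕜}
    {μ : Fin m → 𝕜} (h : ∀ t : ℕ, (Matrix.scalar (Fin m) (t : 𝕜) - M).det = ∏ i, ((t : 𝕜) - μ i)) :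
    M.charpoly = ∏ i, (X - C (μ i)) := by
  refine Polynomial.eq_of_infinite_eval_eq _ _
    ((Set.infinite_range_of_injective (Nat.cast_injective (R := 𝕜))).mono ?_)
  rintro _ ⟨t, rfl⟩
  simp only [Set.mem_ofPred_eq, Matrix.eval_charpoly, h t, eval_prod, eval_sub, eval_X, eval_C]

theorem det_eq_of_charpoly_eq {𝕜 : Type*} [RCLike 𝕜] {m : ℕ} {M : Matrix (Fin m) (Fin m) 𝕜}
    {μ : Fin m → 𝕜} (h : M.charpoly = ∏ i, (X - C (μ i))) (t : 𝕜) :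
    (Matrix.scalar (Fin m) t - M).det = ∏ i, (t - μ i) := by
  rw [← Matrix.eval_charpoly, h]
  simp only [eval_prod, eval_sub, eval_X, eval_C]

variable {α : Type*} [MeasurableSpace α] {ρ : Measure α}

/-- The vectors realizing interlacing spectra can be chosen measurably. -/
theorem exists_aemeasurable_vectors_of_interlacing (n : ℕ) (l : ℕ → ℕ → α → ℝ) {c : ℝ}
    (hl : ∀ j i, AEMeasurable (l j i) ρ)
    (h : ∀ᵐ x ∂ρ, (∀ j < n, ∀ i < j, l j i x ≤ l (j + 1) i x) ∧
      (∀ j < n, ∀ i < j, l (j + 1) (i + 1) x ≤ l j i x) ∧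
      (∀ i < n, 0 ≤ l n i x) ∧ ∀ i < n, l n i x ≤ c) :
    ∃ V : Fin n → Fin n → α → ℝ, (∀ a b, AEMeasurable (V a b) ρ) ∧ ∀ᵐ x ∂ρ,
      (∀ j (hj : j ≤ n), (Matrix.of fun a b : Fin j =>
        ∑ i, V i (Fin.castLE hj a) x * V i (Fin.castLE hj b) x).charpoly
          = ∏ i : Fin j, (X - C (l j i x))) ∧
      ∀ a b, ∑ j, V a j x * V b j x = if a = b then l n a x else 0 := by
  -- Φ collects the two families of equations for V: spectra of the leading Gram matrices, and inner
  -- products of the rows. The prescribed values are y.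
  let Φ : (Fin n × Fin n → ℝ) → ((Fin (n + 1) × ℕ → ℝ) × (Fin n × Fin n → ℝ)) := fun V =>
    (fun p => (Matrix.scalar (Fin p.1) (p.2 : ℝ) - Matrix.of fun a b : Fin p.1 =>
      ∑ i, V (i, Fin.castLE p.1.is_le a) * V (i, Fin.castLE p.1.is_le b)).det,
    fun q => ∑ j, V (q.1, j) * V (q.2, j))
  let y : α → ((Fin (n + 1) × ℕ → ℝ) × (Fin n × Fin n → ℝ)) := fun x =>
    (fun p => ∏ i : Fin p.1, ((p.2 : ℝ) - l p.1 i x),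
      fun q => if q.1 = q.2 then l n q.1 x else 0)
  have hΦ : Continuous Φ := by
    refine Continuous.prodMk (continuous_pi fun p => Continuous.matrix_det ?_)
      (continuous_pi fun q => by fun_prop)
    refine continuous_const.sub (continuous_matrix fun a b => ?_)
    simp only [Matrix.of_apply]
    fun_prop
  have hy : AEMeasurable y ρ := by
    refine AEMeasurable.prodMk (aemeasurable_pi_iff.mpr fun p => ?_)
      (aemeasurable_pi_iff.mpr fun q => ?_)
    · exact Finset.aemeasurable_fun_prod _ fun i _ => aemeasurable_const.sub (hl _ _)
    · by_cases hq : q.1 = q.2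
      · simpa [hq] using hl _ _
      · simp [hq]
  have hK : IsCompact (Set.univ.pi fun _ : Fin n × Fin n => Set.Icc (-(c + 1)) (c + 1)) :=
    isCompact_univ_pi fun _ => isCompact_Icc
  obtain ⟨s, hs, hsK⟩ := exists_measurable_rightInverse hK hΦ
  refine ⟨fun a b x => s (y x) (a, b), fun a b =>
    ((measurable_pi_apply (a, b)).comp hs).comp_aemeasurable hy, ?_⟩
  filter_upwards [h] with x ⟨h1, h2, h0, hc⟩
  obtain ⟨V, hV, hV'⟩ := exists_vectors_of_interlacing n (fun j i => l j i x) h1 h2 h0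
  have hVy : Φ (fun q => V q.1 q.2) = y x := by
    refine Prod.ext (funext fun p => ?_) (funext fun q => hV' q.1 q.2)
    exact det_eq_of_charpoly_eq (hV p.1 p.1.is_le) _
  have hVK : (fun q : Fin n × Fin n => V q.1 q.2)
      ∈ Set.univ.pi fun _ : Fin n × Fin n => Set.Icc (-(c + 1)) (c + 1) := by
    rintro ⟨a, b⟩ -
    -- A row has squared norm λ_a ≤ c, so each entry is bounded by √c ≤ c + 1. This is the compact
    -- box.
    have h3 : V a b ^ 2 ≤ l n a x := by
      have h4 := hV' a a
      rw [if_pos rfl] at h4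
      rw [← h4, sq]
      exact Finset.single_le_sum (f := fun j => V a j * V a j) (fun j _ => mul_self_nonneg _)
        (Finset.mem_univ b)
    have h4 := hc a a.isLt
    have h5 := h0 a a.isLt
    exact abs_le.mp (abs_le_of_sq_le_sq (by nlinarith) (by linarith))
  have hsV := (hsK _ hVK).2
  rw [hVy] at hsV
  refine ⟨fun j hj => charpoly_eq_of_det_eq fun t => ?_, fun a b => ?_⟩
  · exact congrFun (congrArg Prod.fst hsV) (⟨j, Nat.lt_succ_of_le hj⟩, t)
  · exact congrFun (congrArg Prod.snd hsV) (a, b)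

/-- The roots of a measurable field of real rooted polynomials can be chosen measurably. -/
theorem exists_aemeasurable_roots {m : ℕ} {c : ℝ} {q : ℕ → α → ℝ}
    (hq : ∀ t, AEMeasurable (q t) ρ)
    (h : ∀ᵐ x ∂ρ, ∃ μ : Fin m → ℝ≥0, Antitone μ ∧ (∀ i, (μ i : ℝ) ≤ c) ∧
      ∀ t, q t x = ∏ i, ((t : ℝ) - μ i)) :
    ∃ μ : Fin m → α → ℝ≥0, (∀ i, AEMeasurable (μ i) ρ) ∧
      ∀ᵐ x ∂ρ, (Antitone fun i => μ i x) ∧ ∀ t, q t x = ∏ i, ((t : ℝ) - μ i x) := by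
  let Φ : (Fin m → ℝ) → ℕ → ℝ := fun μ t => ∏ i, ((t : ℝ) - μ i)
  have hΦ : Continuous Φ := continuous_pi fun t => by fun_prop
  have hK : IsCompact ((Set.univ.pi fun _ : Fin m => Set.Icc 0 c) ∩
      ⋂ p : Fin m × Fin m, {μ : Fin m → ℝ | p.1 ≤ p.2 → μ p.2 ≤ μ p.1}) := by
    refine (isCompact_univ_pi fun _ => isCompact_Icc).inter_right (isClosed_iInter fun p => ?_)
    by_cases hp : p.1 ≤ p.2
    · simpa [hp] using isClosed_le (continuous_apply p.2) (continuous_apply p.1)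
    · simp [hp]
  obtain ⟨s, hs, hsK⟩ := exists_measurable_rightInverse hK hΦ
  have hqm : AEMeasurable (fun x t => q t x) ρ := aemeasurable_pi_iff.mpr hq
  refine ⟨fun i x => (s (fun t => q t x) i).toNNReal, fun i =>
    (((measurable_pi_apply i).comp hs).comp_aemeasurable hqm).real_toNNReal, ?_⟩
  filter_upwards [h] with x ⟨μ, hμ, hc, hμq⟩
  have h1 : Φ (fun i => (μ i : ℝ)) = fun t => q t x := funext fun t => (hμq t).symm
  have h2 := hsK (fun i => (μ i : ℝ)) ⟨fun i _ => ⟨(μ i).2, hc i⟩,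
    Set.mem_iInter.mpr fun p hp => by exact_mod_cast hμ hp⟩
  rw [h1] at h2
  obtain ⟨⟨h3, h4⟩, h5⟩ := h2
  refine ⟨fun a b hab => Real.toNNReal_le_toNNReal (Set.mem_iInter.mp h4 (a, b) hab),
    fun t => ?_⟩
  rw [← congrFun h5 t]
  refine Finset.prod_congr rfl fun i _ => ?_
  rw [Real.coe_toNNReal _ (h3 i trivial).1]

/-- The eigenvalues of the Gram matrix of a measurable field of vectors can be chosen
measurably. -/
theorem exists_aemeasurable_charpoly_gram {k m : ℕ} {c : ℝ} {φ : Fin m → α → SeqL2 k}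
    (hφ : ∀ i, AEStronglyMeasurable (φ i) ρ) (hc : ∀ i, ∀ᵐ x ∂ρ, ‖φ i x‖ ≤ c) :
    ∃ μ : Fin m → α → ℝ≥0, (∀ i, AEMeasurable (μ i) ρ) ∧
      ∀ᵐ x ∂ρ, (Antitone fun i => μ i x) ∧
        (Matrix.gram ℂ fun i => φ i x).charpoly = ∏ i, (X - C ((μ i x : ℝ) : ℂ)) := by
  -- The determinant is real because the Gram matrix has real eigenvalues; taking real parts loses
  -- nothing.
  let q : ℕ → α → ℝ := fun t x =>
    (Matrix.scalar (Fin m) (t : ℂ) - Matrix.gram ℂ fun i => φ i x).det.re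
  have hq : ∀ t, AEMeasurable (q t) ρ := by
    intro t
    refine Complex.measurable_re.comp_aemeasurable ?_
    simp only [Matrix.det_apply]
    refine Finset.aemeasurable_fun_sum _ fun σ _ => AEMeasurable.const_smul
      (Finset.aemeasurable_fun_prod _ fun i _ => ?_) _
    simp only [Matrix.sub_apply, Matrix.gram_apply]
    exact aemeasurable_const.sub ((hφ _).inner (hφ _)).aemeasurable
  have hroots : ∀ᵐ x ∂ρ, ∃ μ : Fin m → ℝ≥0, Antitone μ ∧ (∀ i, (μ i : ℝ) ≤ m * c ^ 2) ∧
      ∀ t, q t x = ∏ i, ((t : ℝ) - μ i) := by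
    filter_upwards [ae_all_iff.mpr hc] with x hx
    obtain ⟨ν, hν, hν'⟩ := exists_charpoly_gram fun i => φ i x
    refine ⟨ν, hν, fun i => ?_, fun t => ?_⟩
    · have h1 := sum_norm_sq_of_charpoly_gram _ hν'
      calc (ν i : ℝ) ≤ ∑ i, (ν i : ℝ) :=
            Finset.single_le_sum (f := fun i => (ν i : ℝ)) (fun i _ => (ν i).2) (Finset.mem_univ i)
        _ = ∑ i, ‖φ i x‖ ^ 2 := h1.symm
        _ ≤ ∑ _i : Fin m, c ^ 2 := by
            gcongr with i
            exact hx i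
        _ = m * c ^ 2 := by simp
    · simp only [q]
      rw [det_eq_of_charpoly_eq hν' (t : ℂ)]
      have h5 : ∏ i, ((t : ℂ) - ((ν i : ℝ) : ℂ)) = ((∏ i, ((t : ℝ) - ν i) : ℝ) : ℂ) := by
        push_cast; rfl
      rw [h5, Complex.ofReal_re]
  obtain ⟨μ, hμ, hμ'⟩ := exists_aemeasurable_roots hq hroots
  refine ⟨μ, hμ, ?_⟩
  filter_upwards [hμ'] with x ⟨h1, h2⟩
  refine ⟨h1, charpoly_eq_of_det_eq fun t => ?_⟩
  obtain ⟨ν, -, hν⟩ := exists_charpoly_gram fun i => φ i x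
  have h3 := det_eq_of_charpoly_eq hν (t : ℂ)
  have h4 : (Matrix.scalar (Fin m) (t : ℂ) - Matrix.gram ℂ fun i => φ i x).det.re
        = _ := h2 t
  rw [h3] at h4 ⊢
  have h5 : ∏ i, ((t : ℂ) - ((ν i : ℝ) : ℂ)) = ((∏ i, ((t : ℝ) - ν i) : ℝ) : ℂ) := by
    push_cast; rfl
  rw [h5, Complex.ofReal_re] at h4
  rw [h5, h4]
  push_cast
  rfl

end EigenvalueSelection

/-! ### Eigensteps and generators -/

section Eigensteps

open Polynomial

variable {k n : ℕ} {lam al : Fin n → torus k → ℝ≥0}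

/-- Adding one vector makes the eigenvalues of the frame operator interlace. -/
theorem IsEigenvalueSeq.interlacing {H : Type*} [NormedAddCommGroup H] [InnerProductSpace ℂ H]
    {m : ℕ} (φ : Fin (m + 1) → H) {μ ν : ℕ → ℝ≥0}
    (hμ : IsEigenvalueSeq (frameOp fun i : Fin m => φ i.castSucc) μ)
    (hν : IsEigenvalueSeq (frameOp φ) ν) (i : ℕ) : μ i ≤ ν i ∧ ν (i + 1) ≤ μ i := by
  constructor
  · refine hμ.le_of_codim hν (p := 0) Fin.elim0 (fun ξ _ => ?_) i
    rw [re_inner_frameOp, re_inner_frameOp, Fin.sum_univ_castSucc]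
    exact le_add_of_nonneg_right (sq_nonneg _)
  · refine hν.le_of_codim hμ (p := 1) (fun _ => φ (Fin.last m)) (fun ξ hξ => ?_) i
    rw [re_inner_frameOp, re_inner_frameOp, Fin.sum_univ_castSucc, hξ 0]
    simp

theorem Admissible.al_le {W : Submodule ℂ (L2 k)} (hadm : Admissible W lam al) {C : ℝ≥0}
    (hC : ∀ i, ∀ᵐ x : torus k, lam i x ≤ C) (i : Fin n) : ∀ᵐ x : torus k, al i x ≤ n * C := by
  filter_upwards [hadm.2, ae_all_iff.mpr hC] with x h hx
  calc al i x ≤ ∑ i, al i x := Finset.single_le_sum (f := fun i => al i x)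
        (fun _ _ => zero_le) (Finset.mem_univ i)
    _ = ∑ i ∈ Finset.range (fiberDim W x), zeroExt (fun i => lam i x) i := by
        rw [h.2, Fin.sum_univ_eq_sum_range (zeroExt fun i => lam i x)]
    _ ≤ ∑ i ∈ Finset.range n, zeroExt (fun i => lam i x) i := by
        -- If d(x) > n the additional terms are zeros of the extension.
        refine Finset.sum_le_sum_of_ne_zero fun j _ hj => ?_
        by_contra hn
        exact hj (dif_neg fun h => hn (Finset.mem_range.mpr h))
    _ = ∑ i : Fin n, lam i x := by
        rw [← Fin.sum_univ_eq_sum_range]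
        exact Finset.sum_congr rfl fun i _ => zeroExt_val _ i
    _ ≤ ∑ _i : Fin n, C := Finset.sum_le_sum fun i _ => hx i
    _ = n * C := by simp

theorem norm_le_of_sq_eq {E : Type*} [NormedAddCommGroup E] {v : E} {a b : ℝ≥0}
    (h : ‖v‖ ^ 2 = a) (hab : a ≤ b) : ‖v‖ ≤ b + 1 := by
  have h1 : (a : ℝ) ≤ b := hab
  have h2 := b.2
  refine abs_le_of_sq_le_sq' ?_ (by positivity) |>.2
  nlinarith

/-- The eigenvalues of the successive frame operators form a sequence of eigensteps. -/
theorem HasFineStructure.exists_eigensteps {F : Fin n → L2 k} {c : ℝ}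
    (hF : ∀ i, ∀ᵐ x : torus k, ‖fiber (F i) x‖ ≤ c) (hfs : HasFineStructure F lam al) :
    ∃ L : (j : Fin n) → Fin (j + 1) → torus k → ℝ≥0,
      IsEigensteps lam al L ∧ IsAssociated F L := by
  have hex : ∀ j : Fin n, _ := fun j => exists_aemeasurable_charpoly_gram (ρ := volume) (c := c)
    (φ := fun (i : Fin (j + 1)) (x : torus k) => fiber (F (Fin.castLE j.isLt i)) x)
    (fun i => aestronglyMeasurable_fiber _) (fun i => hF _)
  choose L hLm hL using hex
  have hE : ∀ j : Fin n, ∀ᵐ x : torus k,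
      IsEigenvalueSeq (frameOp fun i : Fin (j + 1) => fiber (F (Fin.castLE j.isLt i)) x)
        (zeroExt fun i => L j i x) := by
    intro j
    filter_upwards [hL j] with x ⟨h1, h2⟩
    exact isEigenvalueSeq_frameOp _ h1 h2
  refine ⟨L, ⟨hLm, fun j hj i => ?_, fun j => ?_, fun j hjn i => ?_⟩, fun j => ?_⟩
  · filter_upwards [hE ⟨j, Nat.lt_of_succ_lt hj⟩, hE ⟨j + 1, hj⟩] with x h1 h2
    have h3 := IsEigenvalueSeq.interlacing
      (fun i : Fin (j + 1 + 1) => fiber (F (Fin.castLE hj i)) x) h1 h2 i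
    have e1 := zeroExt_val (fun i => L ⟨j, Nat.lt_of_succ_lt hj⟩ i x) i
    have e2 := zeroExt_val (fun i => L ⟨j + 1, hj⟩ i x) i.castSucc
    have e3 := zeroExt_val (fun i => L ⟨j + 1, hj⟩ i x) i.succ
    exact ⟨e1.symm.le.trans (h3.1.trans e2.le), e3.symm.le.trans (h3.2.trans e1.le)⟩
  -- The trace of the Gram matrix of the first j + 1 fibers is the sum of their squared norms, which
  -- are prescribed.
  · filter_upwards [hL j, ae_all_iff.mpr hfs.2] with x ⟨_, h1⟩ h2
    have h3 := sum_norm_sq_of_charpoly_gram _ h1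
    simp only [h2] at h3
    exact_mod_cast h3.symm
  · have h1 := (hasFineSpectrum_iff hF lam).mp hfs.1
    obtain ⟨j, hj⟩ := j
    dsimp only at hjn i
    subst hjn
    filter_upwards [h1, hE ⟨j, hj⟩] with x h2 h3
    have h4 := congrFun (h3.unique h2) i
    rwa [zeroExt_val (fun i => L ⟨j, hj⟩ i x) i, zeroExt_val (fun i => lam i x) i] at h4
  · exact (hasFineSpectrum_iff (fun i => hF _) (L j)).mpr (hE j)

/-- Two neighbouring entries of a level are separated by an entry of the previous level; the first
level has only one entry. -/
theorem IsEigensteps.antitone {L : (j : Fin n) → Fin (j + 1) → torus k → ℝ≥0}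
    (hL : IsEigensteps lam al L) (j : Fin n) : ∀ᵐ x : torus k, Antitone fun i => L j i x := by
  obtain ⟨j, hj⟩ := j
  cases j with
  | zero => exact Filter.Eventually.of_forall fun x a b _ =>
      (Subsingleton.elim (α := Fin 1) a b ▸ le_rfl)
  | succ j =>
    filter_upwards [ae_all_iff.mpr (hL.interlacing j hj)] with x hx
    exact Fin.antitone_iff_succ_le.mpr fun i => (hx i).2.trans (hx i).1

/-- Eigensteps as real numbers, indexed by the number of vectors. -/
def stepValue (L : (j : Fin n) → Fin (j + 1) → torus k → ℝ≥0) : ℕ → ℕ → torus k → ℝ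
  | 0, _, _ => 0
  | j + 1, i, x => if h : j < n then zeroExt (fun i' => L ⟨j, h⟩ i' x) i else 0

theorem stepValue_succ (L : (j : Fin n) → Fin (j + 1) → torus k → ℝ≥0) {j : ℕ} (hj : j < n)
    (i : Fin (j + 1)) (x : torus k) : stepValue L (j + 1) i x = L ⟨j, hj⟩ i x := by
  rw [stepValue, dif_pos hj, zeroExt_val (fun i' => L ⟨j, hj⟩ i' x) i]

theorem IsEigensteps.aemeasurable_stepValue {L : (j : Fin n) → Fin (j + 1) → torus k → ℝ≥0}
    (hL : IsEigensteps lam al L) (j i : ℕ) : AEMeasurable (stepValue L j i) volume := by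
  cases j with
  | zero => exact aemeasurable_const
  | succ j =>
    by_cases hj : j < n
    · by_cases hi : i < j + 1
      · have e : stepValue L (j + 1) i = fun x => (L ⟨j, hj⟩ ⟨i, hi⟩ x : ℝ) :=
          funext fun x => stepValue_succ L hj ⟨i, hi⟩ x
        rw [e]
        exact (hL.measurable _ _).coe_nnreal_real
      · have e : stepValue L (j + 1) i = fun _ => 0 := by
          funext x
          simp [stepValue, hj, zeroExt, hi]
        rw [e]
        exact aemeasurable_const
    · have e : stepValue L (j + 1) i = fun _ => 0 := by
        funext x
        simp [stepValue, hj]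
      rw [e]
      exact aemeasurable_const

theorem IsEigensteps.stepValue_eq_lam {L : (j : Fin n) → Fin (j + 1) → torus k → ℝ≥0}
    (hL : IsEigensteps lam al L) : ∀ᵐ x : torus k, ∀ i : Fin n, stepValue L n i x = lam i x := by
  refine ae_all_iff.mpr fun i => ?_
  cases n with
  | zero => exact i.elim0
  | succ m =>
    filter_upwards [hL.final (Fin.last m) rfl i] with x hx
    rw [stepValue_succ L (Nat.lt_succ_self m) i]
    exact congrArg _ hx

theorem IsEigensteps.antitone_lam {L : (j : Fin n) → Fin (j + 1) → torus k → ℝ≥0}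
    (hL : IsEigensteps lam al L) : ∀ᵐ x : torus k, Antitone fun i => lam i x := by
  cases n with
  | zero => exact Filter.Eventually.of_forall fun x a => a.elim0
  | succ m =>
    filter_upwards [ae_all_iff.mpr (hL.final (Fin.last m) rfl), hL.antitone (Fin.last m)]
      with x hx hanti a b hab
    have ha : _ = lam a x := hx a
    have hb : _ = lam b x := hx b
    exact hb.symm.le.trans ((hanti hab).trans ha.le)

theorem IsEigensteps.stepValue_interlacing {L : (j : Fin n) → Fin (j + 1) → torus k → ℝ≥0}
    (hL : IsEigensteps lam al L) : ∀ᵐ x : torus k,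
      (∀ j < n, ∀ i < j, stepValue L j i x ≤ stepValue L (j + 1) i x) ∧
      ∀ j < n, ∀ i < j, stepValue L (j + 1) (i + 1) x ≤ stepValue L j i x := by
  have h : ∀ᵐ x : torus k, ∀ (j : ℕ) (hj : j + 1 < n) (i : Fin (j + 1)),
      L ⟨j, Nat.lt_of_succ_lt hj⟩ i x ≤ L ⟨j + 1, hj⟩ i.castSucc x ∧
      L ⟨j + 1, hj⟩ i.succ x ≤ L ⟨j, Nat.lt_of_succ_lt hj⟩ i x := by
    simp only [ae_all_iff]
    exact hL.interlacing
  filter_upwards [h] with x hx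
  refine ⟨fun j hj i hi => ?_, fun j hj i hi => ?_⟩
  · obtain ⟨j, rfl⟩ := Nat.exists_eq_succ_of_ne_zero (Nat.ne_zero_of_lt hi)
    have h1 := (hx j hj ⟨i, hi⟩).1
    have e1 := stepValue_succ L (Nat.lt_of_succ_lt hj) ⟨i, hi⟩ x
    have e2 := stepValue_succ L hj (⟨i, hi⟩ : Fin (j + 1)).castSucc x
    exact e1.le.trans ((NNReal.coe_le_coe.mpr h1).trans e2.symm.le)
  · obtain ⟨j, rfl⟩ := Nat.exists_eq_succ_of_ne_zero (Nat.ne_zero_of_lt hi)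
    have h1 := (hx j hj ⟨i, hi⟩).2
    have e1 := stepValue_succ L (Nat.lt_of_succ_lt hj) ⟨i, hi⟩ x
    have e2 := stepValue_succ L hj (⟨i, hi⟩ : Fin (j + 1)).succ x
    exact e2.le.trans ((NNReal.coe_le_coe.mpr h1).trans e1.symm.le)

/-- Vectors in an orthonormal system with prescribed Gram matrix. -/
theorem gram_sum_smul {H : Type*} [NormedAddCommGroup H] [InnerProductSpace ℂ H] {d : ℕ}
    {E : ℕ → H} (hE : ∀ i j, inner ℂ (E i) (E j) = if i = j ∧ i < d then 1 else 0)
    {V : Fin n → Fin n → ℝ} (hV : ∀ a b : Fin n, d ≤ (a : ℕ) → V a b = 0) (b b' : Fin n) :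
    inner ℂ (∑ a, (V a b : ℂ) • E a) (∑ a, (V a b' : ℂ) • E a)
      = ((∑ a, V a b * V a b' : ℝ) : ℂ) := by
  rw [sum_inner]
  push_cast
  refine Finset.sum_congr rfl fun a _ => ?_
  rw [inner_sum, Finset.sum_eq_single a]
  · rw [inner_smul_left, inner_smul_right, hE]
    by_cases ha : (a : ℕ) < d
    · simp [ha]
    · simp [hV a _ (not_lt.mp ha)]
  · intro c _ hc
    have : (a : ℕ) ≠ c := fun h => hc (Fin.ext h.symm)
    rw [inner_smul_left, inner_smul_right, hE]
    simp [this]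
  · simp

theorem eq_of_partial_sums {u v : Fin n → ℝ}
    (h : ∀ (j : ℕ) (hj : j ≤ n), ∑ i : Fin j, u (Fin.castLE hj i) = ∑ i : Fin j, v (Fin.castLE hj i)) :
    u = v := by
  funext b
  have h1 := h (b + 1) b.isLt
  have h2 := h b b.isLt.le
  rw [Fin.sum_univ_castSucc, Fin.sum_univ_castSucc] at h1
  have e : Fin.castLE b.isLt (Fin.last b) = b := rfl
  rw [e] at h1
  simp only [Fin.castLE_castSucc] at h1
  linarith

/-- Every sequence of eigensteps is realized in the given shift invariant space. -/
theorem IsEigensteps.exists_generators {W : Submodule ℂ (L2 k)} (hW : IsFSI W) {R : ℝ≥0}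
    (hR : ∀ i, ∀ᵐ x : torus k, lam i x ≤ R) (hadm : Admissible W lam al)
    {L : (j : Fin n) → Fin (j + 1) → torus k → ℝ≥0} (hL : IsEigensteps lam al L) :
    ∃ F : Fin n → L2 k, (∀ i, F i ∈ W) ∧ IsBessel (shiftSeq F) ∧
      IsAssociated F L ∧ HasFineStructure F lam al := by
  obtain ⟨E, hEm, hE, hEW⟩ := hW.exists_orthonormal_field
  have hRall := ae_all_iff.mpr hR
  obtain ⟨V, hVm, hV⟩ := exists_aemeasurable_vectors_of_interlacing (ρ := volume) (c := R) n
    (stepValue L) hL.aemeasurable_stepValue (by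
      filter_upwards [hL.stepValue_interlacing, hL.stepValue_eq_lam, hRall] with x h1 h2 h3
      refine ⟨h1.1, h1.2, fun i hi => ?_, fun i hi => ?_⟩
      · rw [h2 ⟨i, hi⟩]; exact NNReal.coe_nonneg _
      · rw [h2 ⟨i, hi⟩]; exact h3 ⟨i, hi⟩)
  -- The columns of V as coordinates in the orthonormal field; the field vanishes from index d(x)
  -- on.
  let φ : Fin n → torus k → SeqL2 k := fun b x => ∑ a, (V a b x : ℂ) • E a x
  have hφm : ∀ b, AEStronglyMeasurable (φ b) volume := fun b =>
    Finset.aestronglyMeasurable_fun_sum _ fun a _ =>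
      (Complex.measurable_ofReal.comp_aemeasurable (hVm a b)).aestronglyMeasurable.smul
        (hEm a).aestronglyMeasurable
  have hgram : ∀ᵐ x : torus k, ∀ (j : ℕ) (hj : j ≤ n),
      (Matrix.gram ℂ fun i : Fin j => φ (Fin.castLE hj i) x).charpoly
        = ∏ i : Fin j, (X - C ((stepValue L j i x : ℝ) : ℂ)) := by
    filter_upwards [hE, hV, hL.stepValue_eq_lam, ae_all_iff.mpr hadm.1] with x h1 h2 h3 h4 j hj
    -- Row a has squared norm λ_a, which is zero beyond d(x) by admissibility. So no mass is lost
    -- where the orthonormal field vanishes.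
    have hV0 : ∀ a b : Fin n, fiberDim W x ≤ (a : ℕ) → V a b x = 0 := by
      intro a b hab
      have h5 := h2.2 a a
      rw [if_pos rfl, h3, h4 a ((min_le_right _ _).trans hab), NNReal.coe_zero,
        Finset.sum_eq_zero_iff_of_nonneg fun j _ => mul_self_nonneg _] at h5
      exact mul_self_eq_zero.mp (h5 b (Finset.mem_univ b))
    have h5 : (Matrix.gram ℂ fun i : Fin j => φ (Fin.castLE hj i) x)
        = (Matrix.of fun a b : Fin j =>
          ∑ i, V i (Fin.castLE hj a) x * V i (Fin.castLE hj b) x).map Complex.ofRealHom := by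
      ext a b
      exact gram_sum_smul h1 (V := fun a b => V a b x) hV0 _ _
    rw [h5, Matrix.charpoly_map, h2.1 j hj, Polynomial.map_prod]
    simp
  have hstep : ∀ (j : Fin n), ∀ᵐ x : torus k,
      (Matrix.gram ℂ fun i : Fin (j + 1) => φ (Fin.castLE j.isLt i) x).charpoly
        = ∏ i : Fin (j + 1), (X - C ((L j i x : ℝ) : ℂ)) := by
    intro j
    filter_upwards [hgram] with x hx
    rw [hx (j + 1) j.isLt]
    simp only [stepValue_succ L j.isLt]
  -- Only sums of squared norms are known, as traces; differences of consecutive ones give the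
  -- single norms.
  have hnorm : ∀ᵐ x : torus k, ∀ i, ‖φ i x‖ ^ 2 = al i x := by
    filter_upwards [hgram, ae_all_iff.mpr hstep, ae_all_iff.mpr hL.trace] with x h1 h2 h3 i
    refine congrFun (eq_of_partial_sums (u := fun i => ‖φ i x‖ ^ 2) (v := fun i => (al i x : ℝ))
      fun j hj => ?_) i
    cases j with
    | zero => simp
    | succ j =>
      refine (sum_norm_sq_of_charpoly_gram _ (h2 ⟨j, hj⟩)).trans ?_
      exact_mod_cast congrArg NNReal.toReal (h3 ⟨j, hj⟩)
  have hbound : ∀ i, ∀ᵐ x : torus k, ‖φ i x‖ ≤ (n * R : ℝ≥0) + 1 := by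
    intro i
    filter_upwards [hnorm, hadm.al_le hR i] with x h1 h2
    exact norm_le_of_sq_eq (h1 i) h2
  have hex : ∀ i, ∃ f : L2 k, ∀ᵐ x : torus k, fiber f x = φ i x := fun i =>
    exists_fiber_eq_of_bounded (hφm i) (hbound i)
  choose F hF using hex
  have hFall := ae_all_iff.mpr hF
  have hFb : ∀ i, ∀ᵐ x : torus k, ‖fiber (F i) x‖ ≤ (n * R : ℝ≥0) + 1 := by
    intro i
    filter_upwards [hF i, hbound i] with x h1 h2
    rwa [h1]
  refine ⟨F, fun i => hEW _ ?_, isBessel_shiftSeq hFb, fun j => ?_, ?_, fun i => ?_⟩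
  · filter_upwards [hF i] with x hx
    rw [hx]
    exact Submodule.sum_mem _ fun a _ => Submodule.smul_mem _ _
      (Submodule.subset_span (Set.mem_range_self (a : ℕ)))
  · rw [hasFineSpectrum_iff fun i => hFb _]
    filter_upwards [hstep j, hL.antitone j, hFall] with x h1 h2 h3
    simp only [h3]
    exact isEigenvalueSeq_frameOp _ h2 h1
  · rw [hasFineSpectrum_iff hFb]
    filter_upwards [hgram, hL.antitone_lam, hL.stepValue_eq_lam, hFall] with x h1 h2 h3 h4
    simp only [h4]
    refine isEigenvalueSeq_frameOp _ h2 ?_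
    exact (h1 n le_rfl).trans (by simp only [h3])
  · filter_upwards [hF i, hnorm] with x h1 h2
    rw [h1, h2]

end Eigensteps

end

end ShiftGenerated

/-! ### The two directions combined -/

open ShiftGenerated
theorem theorem3p10 {k n : ℕ} (W : Submodule ℂ (L2 k)) (hW : IsFSI W)
    (lam al : Fin n → torus k → ℝ≥0)
    (hlam : ∀ i, AEMeasurable (lam i) volume) (hal : ∀ i, AEMeasurable (al i) volume)
    (hbdd : ∃ C : ℝ≥0, ∀ i, ∀ᵐ x : torus k, lam i x ≤ C)
    (hadm : Admissible W lam al) :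
    (∀ L : (j : Fin n) → Fin (j + 1) → torus k → ℝ≥0, IsEigensteps lam al L →
      ∃ F : Fin n → L2 k, (∀ i, F i ∈ W) ∧ IsBessel (shiftSeq F) ∧
        IsAssociated F L ∧ HasFineStructure F lam al) ∧
    (∀ F : Fin n → L2 k, (∀ i, F i ∈ W) → IsBessel (shiftSeq F) → HasFineStructure F lam al →
      ∃ L : (j : Fin n) → Fin (j + 1) → torus k → ℝ≥0,
        IsEigensteps lam al L ∧ IsAssociated F L) := by
  obtain ⟨C, hC⟩ := hbdd
  refine ⟨fun L hL => hL.exists_generators hW hC hadm, fun F _ _ hfs => ?_⟩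
  -- The fibers satisfy ‖Γfᵢ(x)‖² = αᵢ(x) ≤ nC, and √(nC) ≤ nC + 1.
  refine hfs.exists_eigensteps (c := (n * C : ℝ≥0) + 1) fun i => ?_
  filter_upwards [hfs.2 i, hadm.al_le hC i] with x h1 h2
  exact norm_le_of_sq_eq h1 h2
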